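/- Let $p\ge 5$ be a prime, let $R=\widehat{\mathbb Z_p^{\rm ur}}$ (the ring of Witt vectors of an algebraic closure of $\mathbb F_p$), let $K$ be its fraction field and $K^{\rm alg}$ an algebraic closure of $K$, and let $\phi$ be an automorphism of $K^{\rm alg}$ extending the automorphism of $R$ that lifts the $p$-power Frobenius of $R/pR$. Let $\pi\in K^{\rm alg}$ be a root of an Eisenstein polynomial with coefficients in $\mathbb Z_p^{\rm ur}$ such that $\mathbb Q_p(\pi)/\mathbb Q_p$ is Galois; put $K_\pi=K(\pi)$, $R_\pi=R[\pi]$, $e=e(\pi)=[K_\pi:K]$, $\delta_\pi x=(\phi(x)-x^p)/\pi$ on $R_\pi$, $\delta=\delta_p$, and $$\nu:=\left[\frac{\log e}{\log p}\right]+2 .$$ A $\pi$-derivation from an $R_\pi$-algebra $A$ to an $A$-algebra $B$ is a map $\delta_\pi:A\to B$ with $\delta_\pi 1=0$, $\delta_\pi(x+y)=\delta_\pi x+\delta_\pi y+\frac{1}{\pi}(X^p+Y^p-(X+Y)^p)|_{X=x,Y=y}$ and $\delta_\pi(xy)=x^p\delta_\pi y+y^p\delta_\pi x+\pi\,\delta_\pi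 x\,\delta_\pi y$; then $\phi(x)=x^p+\pi\delta_\pi x$ is a ring homomorphism. A $\delta_\pi$-prolongation sequence is a sequence of $R_\pi$-algebras $S^r$, $r\ge 0$, with $R_\pi$-algebra homomorphisms $S^r\to S^{r+1}$ and $\pi$-derivations $\delta_\pi:S^r\to S^{r+1}$ that commute with these homomorphisms and extend $\delta_\pi$ on $R_\pi$. Let ${\bf Prol}_\pi$ be the category of those for which every $S^r$ is Noetherian, $p$-adically complete and flat over $R_\pi$. For an affine scheme $V={\rm Spec}\,A$ of finite type over $R_\pi$, the rings $\mathcal O(J^r_\pi(V))$ form the sequence in ${\bf Prol}_\pi$ with $\mathcal O(J^0_\pi(V))=\widehat A$ (hats denote $p$-adic completion) that is universal among sequences $B^*$ in ${\bf Prol}_\pi$ equipped with an $R_\pi$-algebra homomorphism $A\to B^0$; write $J^r=J^r_p$. Let $X$ be a smooth affine $R$-scheme, $S^r=\mathcal O(J^r(X))$ and $S^r_\pi=\mathcal O(J^r_\pi(X\otimes_R R_\pi))$. The sequence $S^*\otimes_R R_\pi$, with $\phi\otimes\phi$ and $\delta_\pi z=(\phi(z)-z^p)/\pi$, is a $\delta_\pi$-prolongation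 sequence, and universality gives homomorphisms $S^r_\pi\to S^r\otimes_R R_\pi$. Let $\mathcal F$ be a commutative formal group law in $g$ variables over $S^0$ with logarithm $l=(l_k({\bf T}))_{k=1}^g$, $l_k\in(S^0\otimes\mathbb Q)[[{\bf T}]]$, ${\bf T}=(T_1,\dots,T_g)$ (so $l({\bf T})\equiv {\bf T}$ modulo terms of degree $\ge 2$ and $l(\mathcal F({\bf T}_1,{\bf T}_2))=l({\bf T}_1)+l({\bf T}_2)$). For $r\ge0$ put $$L^r_k:=\frac1p\{\phi^r(l_k({\bf T}))\}_{|{\bf T}=0}\in (S^r\otimes\mathbb Q)[[\delta {\bf T},\dots,\delta^r{\bf T}]],$$ where $\delta^i{\bf T}$ are $g$-tuples of new variables and $\phi(\delta^i T_k)=(\delta^iT_k)^p+p\,\delta^{i+1}T_k$. Then the $L^r_k$ belong to $S^r[\delta{\bf T},\dots,\delta^r{\bf T}]^{\widehat{\ }}$; there is a unique natural homomorphism $$S^r_\pi[\delta_\pi{\bf T},\dots,\delta_\pi^r{\bf T}]^{\widehat{\ }}\to S^r[\delta{\bf T},\dots,\delta^r{\bf T}]^{\widehat{\ }}\otimes_R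 R_\pi ,$$ i.e. a unique ring homomorphism that is induced by $S^r_\pi\to S^r\otimes_RR_\pi$ on $S^r_\pi$ and sends $\delta_\pi^iT_k$ to the value at ${\bf T}=0$ of its expression as a polynomial in $T_k,\delta T_k,\dots,\delta^iT_k$ over $R_\pi$; and for all $k=1,\dots,g$ the element $p^\nu L^r_k\otimes 1$ belongs to the image of this homomorphism. -/

import Mathlib

open scoped TensorProduct

universe u

namespace PiJet

/-- The value at `(x, y)` of `C_p(X, Y) = (X ^ p + Y ^ p - (X + Y) ^ p) / p ∈ ℤ[X, Y]`. -/
def cPoly (p : ℕ) {B : Type*} [CommRing B] (x y : B) : B :=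
  -∑ i ∈ Finset.Ico 1 p, ((p.choose i / p : ℕ) : B) * x ^ i * y ^ (p - i)

theorem mul_cPoly (p : ℕ) [hp : Fact p.Prime] {B : Type*} [CommRing B] (x y : B) :
    (p : B) * cPoly p x y = x ^ p + y ^ p - (x + y) ^ p := by
  have h2 := hp.out.two_le
  rw [add_pow, Finset.sum_range_succ, Finset.range_eq_Ico,
    Finset.sum_eq_sum_Ico_succ_bot (by omega : 0 < p), cPoly, mul_neg, Finset.mul_sum]
  have : ∀ i ∈ Finset.Ico 1 p, (p : B) * (((p.choose i / p : ℕ) : B) * x ^ i * y ^ (p - i)) =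
      x ^ i * y ^ (p - i) * (p.choose i : B) := by
    intro i hi
    rw [Finset.mem_Ico] at hi
    have hd : p ∣ p.choose i := hp.out.dvd_choose_self (by omega) (by omega)
    have : (p : B) * ((p.choose i / p : ℕ) : B) = (p.choose i : B) := by
      rw [← Nat.cast_mul, Nat.mul_div_cancel' hd]
    rw [← this]; ring
  rw [Finset.sum_congr rfl this]
  simp
  ring

section Base

variable (p : ℕ) [Fact p.Prime]

/-- `R`, the completion of the ring of integers of `ℚ_p^ur`, realised as the ring of Witt vectors
of an algebraic closure of `𝔽_p`. -/
abbrev R : Type := WittVector p (AlgebraicClosure (ZMod p))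

/-- The fraction field of `R`, i.e. the completion of `ℚ_p^ur`. -/
abbrev K : Type := FractionRing (R p)

/-- An algebraic closure of `K`. -/
abbrev Kalg : Type := AlgebraicClosure (K p)

/-- `ℤ_p = W(𝔽_p) ⊆ R`. -/
noncomputable instance : Algebra ℤ_[p] (R p) :=
  ((WittVector.map (algebraMap (ZMod p) (AlgebraicClosure (ZMod p)))).comp
    (WittVector.fromPadicInt p)).toAlgebra

theorem algebraMap_padicInt_injective : Function.Injective (algebraMap ℤ_[p] (K p)) := by
  rw [IsScalarTower.algebraMap_eq ℤ_[p] (R p) (K p)]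
  refine (IsFractionRing.injective (R p) (K p)).comp ?_
  refine (WittVector.map_injective _ (FaithfulSMul.algebraMap_injective _ _)).comp ?_
  exact Function.LeftInverse.injective (g := WittVector.toPadicInt p)
    (WittVector.toPadicInt_comp_fromPadicInt_ext p)

/-- `ℚ_p ⊆ K`. -/
noncomputable instance : Algebra ℚ_[p] (K p) :=
  (IsFractionRing.lift (algebraMap_padicInt_injective p)).toAlgebra

instance : IsScalarTower ℤ_[p] ℚ_[p] (K p) :=
  IsScalarTower.of_algebraMap_eq fun x =>
    (IsFractionRing.lift_algebraMap (algebraMap_padicInt_injective p) x).symm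

variable {p}

/-- Membership in the set `Π` of all `π` in the algebraic closure of `ℚ_p` inside `Kalg` that are roots of an
Eisenstein polynomial over `ℤ_p^ur` (the elements of `R` that are integral over `ℤ_p`)
and for which `ℚ_p(π) / ℚ_p` is Galois. -/
def IsPi (π : Kalg p) : Prop :=
  (∃ f : Polynomial (R p), f.Monic ∧ f.IsEisensteinAt (Ideal.span {(p : R p)}) ∧
    (∀ n, IsIntegral ℤ_[p] (f.coeff n)) ∧ Polynomial.aeval π f = 0) ∧
  IsGalois ℚ_[p] (IntermediateField.adjoin ℚ_[p] {π})

/-- `φ` extends the automorphism of `R` that lifts the Frobenius of the residue field. -/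
def ExtendsFrobenius (φ : Kalg p ≃+* Kalg p) : Prop :=
  ∀ x : R p, φ (algebraMap (R p) (Kalg p) x) =
    algebraMap (R p) (Kalg p) (WittVector.frobenius x)

/-- `R_π = R[π]`. -/
noncomputable abbrev Rpi (π : Kalg p) : Subalgebra (R p) (Kalg p) := Algebra.adjoin (R p) {π}

/-- `e(π) = [K(π) : K]`. -/
noncomputable def ramIndex (π : Kalg p) : ℕ :=
  Module.finrank (K p) (IntermediateField.adjoin (K p) {π})

theorem dvd_frobenius_sub (x : R p) : (p : R p) ∣ WittVector.frobenius x - x ^ p := by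
  rw [← Ideal.mem_span_singleton, WittVector.mem_span_p_iff_coeff_zero_eq_zero]
  have h : WittVector.constantCoeff (WittVector.frobenius x - x ^ p) = 0 := by
    rw [map_sub, map_pow]
    change (WittVector.frobenius x).coeff 0 - x.coeff 0 ^ p = 0
    rw [WittVector.coeff_frobenius_charP, sub_self]
  exact h

theorem phi_padic {φ : Kalg p ≃+* Kalg p} (hφ : ExtendsFrobenius φ) (x : ℚ_[p]) :
    φ (algebraMap ℚ_[p] (Kalg p) x) = algebraMap ℚ_[p] (Kalg p) x := by
  have h : (φ : Kalg p →+* Kalg p).comp (algebraMap ℚ_[p] (Kalg p)) =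
      algebraMap ℚ_[p] (Kalg p) := by
    apply IsLocalization.ringHom_ext (nonZeroDivisors ℤ_[p])
    ext z
    have e : algebraMap ℚ_[p] (Kalg p) (algebraMap ℤ_[p] ℚ_[p] z) =
        algebraMap (R p) (Kalg p) (algebraMap ℤ_[p] (R p) z) := by
      rw [IsScalarTower.algebraMap_apply ℚ_[p] (K p) (Kalg p),
        ← IsScalarTower.algebraMap_apply ℤ_[p] ℚ_[p] (K p),
        IsScalarTower.algebraMap_apply ℤ_[p] (R p) (K p),
        ← IsScalarTower.algebraMap_apply (R p) (K p) (Kalg p)]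
    simp only [RingHom.comp_apply, RingHom.coe_coe]
    rw [e, hφ]
    congr 1
    ext n
    rw [WittVector.coeff_frobenius_charP]
    change (WittVector.map _ _).coeff n ^ p = (WittVector.map _ _).coeff n
    rw [WittVector.map_coeff, ← map_pow, ZMod.pow_card]
  exact congrArg (fun f => f x) h

theorem phi_pi_mem_adjoin {φ : Kalg p ≃+* Kalg p} (hφ : ExtendsFrobenius φ) {π : Kalg p}
    (hπ : IsPi π) : φ π ∈ IntermediateField.adjoin ℚ_[p] {π} := by
  have := hπ.2
  let σ : Kalg p →ₐ[ℚ_[p]] Kalg p :=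
    { (φ : Kalg p →+* Kalg p) with commutes' := phi_padic hφ }
  have hn : Normal ℚ_[p] (IntermediateField.adjoin ℚ_[p] {π}) := inferInstance
  set x : IntermediateField.adjoin ℚ_[p] {π} :=
    ⟨π, IntermediateField.mem_adjoin_simple_self _ _⟩ with hx
  have hint : IsIntegral ℚ_[p] x := hn.isIntegral x
  have hs := hn.splits x
  rw [IntermediateField.splits_iff_mem (L := Kalg p) (IsAlgClosed.splits _)] at hs
  refine hs _ ?_
  rw [Polynomial.mem_rootSet]
  refine ⟨minpoly.ne_zero hint, ?_⟩
  have h0 : Polynomial.aeval π (minpoly ℚ_[p] x) = 0 := by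
    have := congrArg (algebraMap (IntermediateField.adjoin ℚ_[p] {π}) (Kalg p))
      (minpoly.aeval ℚ_[p] x)
    rwa [map_zero, ← Polynomial.aeval_algebraMap_apply] at this
  have h1 := Polynomial.aeval_algHom_apply σ π (minpoly ℚ_[p] x)
  rw [h0, map_zero] at h1
  exact h1

theorem algebraMap_R_injective : Function.Injective (algebraMap (R p) (Kalg p)) := by
  rw [IsScalarTower.algebraMap_eq (R p) (K p) (Kalg p)]
  exact (algebraMap (K p) (Kalg p)).injective.comp (IsFractionRing.injective (R p) (K p))

instance : Module.IsTorsionFree (R p) (Kalg p) :=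
  Module.isTorsionFree_iff_algebraMap_injective.2 algebraMap_R_injective

theorem minpoly_eq {π : Kalg p} {f : Polynomial (R p)} (hm : f.Monic)
    (he : f.IsEisensteinAt (Ideal.span {(p : R p)})) (h0 : Polynomial.aeval π f = 0) :
    minpoly (R p) π = f := by
  have hint : IsIntegral (R p) π := ⟨f, hm, h0⟩
  have hp : Prime (p : R p) := (WittVector.irreducible p).prime
  have hd : 0 < f.natDegree := by
    rw [Nat.pos_iff_ne_zero]
    intro h
    rw [Polynomial.Monic.natDegree_eq_zero hm] at h
    simp [h] at h0
  have hirr := he.irreducible ((Ideal.span_singleton_prime hp.ne_zero).2 hp) hm.isPrimitive hd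
  obtain ⟨q, hq⟩ := minpoly.isIntegrallyClosed_dvd hint h0
  have hu := (hirr.isUnit_or_isUnit hq).resolve_left (minpoly.not_isUnit (R p) π)
  exact Polynomial.eq_of_monic_of_associated (minpoly.monic hint) hm
    ⟨hu.unit, hq.symm⟩

theorem mem_Rpi_of_isIntegral {π : Kalg p} (hπ : IsPi π) {z : Kalg p}
    (hz : z ∈ IntermediateField.adjoin (K p) {π}) (hi : IsIntegral (R p) z) : z ∈ Rpi π := by
  obtain ⟨⟨f, hm, he, -, h0⟩, -⟩ := hπ
  have hint : IsIntegral (R p) π := ⟨f, hm, h0⟩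
  have hintK : IsIntegral (K p) π := hint.tower_top
  have hp : Prime (p : R p) := (WittVector.irreducible p).prime
  set L := IntermediateField.adjoin (K p) {π} with hL
  have : IsScalarTower (R p) L (Kalg p) := IsScalarTower.of_algebraMap_eq fun _ => rfl
  let B : PowerBasis (K p) L := IntermediateField.adjoin.powerBasis hintK
  have hgen : algebraMap L (Kalg p) B.gen = π := by
    simp [B, IntermediateField.adjoin.powerBasis_gen]
  have hinj : Function.Injective (algebraMap L (Kalg p)) := (algebraMap L (Kalg p)).injective
  have hBint : IsIntegral (R p) B.gen := by
    rw [← isIntegral_algebraMap_iff (B := Kalg p) hinj, hgen]; exact hint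
  have hmin : (minpoly (R p) B.gen).IsEisensteinAt (Ideal.span {(p : R p)}) := by
    rw [← minpoly.algebraMap_eq (B' := Kalg p) hinj, hgen, minpoly_eq hm he h0]; exact he
  let z' : L := ⟨z, hz⟩
  have hz'int : IsIntegral (R p) z' := by
    rw [← isIntegral_algebraMap_iff (B := Kalg p) hinj]; exact hi
  have key : ∃ n : ℕ, (p : R p) ^ n • z' ∈ Algebra.adjoin (R p) ({B.gen} : Set L) := by
    obtain ⟨q, hq⟩ : ∃ q : Polynomial (K p), z' = Polynomial.aeval B.gen q :=
      B.exists_eq_aeval' z'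
    obtain ⟨b, hb0, hb⟩ := IsLocalization.integerNormalization_spec
      (nonZeroDivisors (R p)) q
    obtain ⟨n, c, hc⟩ := WittVector.exists_eq_pow_p_mul' b (nonZeroDivisors.ne_zero hb0)
    refine ⟨n, ?_⟩
    have h1 : b • z' = Polynomial.aeval B.gen
        (IsLocalization.integerNormalization (nonZeroDivisors (R p)) q) := by
      rw [← Polynomial.aeval_map_algebraMap (K p), hb, hq, ← algebraMap_smul (K p) b q, map_smul,
        algebraMap_smul]
    have h2 : (p : R p) ^ n • z' = ((c⁻¹ : (R p)ˣ) : R p) • (b • z') := by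
      rw [smul_smul, hc, mul_comm, mul_assoc, Units.mul_inv, mul_one]
    rw [h2, h1]
    exact Subalgebra.smul_mem _ (Polynomial.aeval_mem_adjoin_singleton _ _) _
  obtain ⟨n, hn⟩ := key
  have := mem_adjoin_of_smul_prime_pow_smul_of_minpoly_isEisensteinAt hp hBint hz'int hn hmin
  have h2 := (Subalgebra.mem_map (f := IsScalarTower.toAlgHom (R p) L (Kalg p))).2
    ⟨z', this, rfl⟩
  rw [AlgHom.map_adjoin] at h2
  simpa [hgen] using h2

theorem isIntegral_pi {π : Kalg p} (hπ : IsPi π) : IsIntegral (R p) π := by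
  obtain ⟨⟨f, hm, -, -, h0⟩, -⟩ := hπ
  exact ⟨f, hm, h0⟩

theorem phi_pi_mem {φ : Kalg p ≃+* Kalg p} (hφ : ExtendsFrobenius φ) {π : Kalg p}
    (hπ : IsPi π) : φ π ∈ Rpi π := by
  refine mem_Rpi_of_isIntegral hπ ?_ ?_
  · have h : IntermediateField.adjoin ℚ_[p] {π} ≤
        (IntermediateField.adjoin (K p) {π}).restrictScalars ℚ_[p] := by
      rw [IntermediateField.adjoin_le_iff, Set.singleton_subset_iff]
      exact IntermediateField.mem_adjoin_simple_self (K p) π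
    exact h (phi_pi_mem_adjoin hφ hπ)
  · obtain ⟨⟨f, hm, -, -, h0⟩, -⟩ := hπ
    refine ⟨f.map WittVector.frobenius, hm.map _, ?_⟩
    rw [Polynomial.eval₂_map]
    have : (algebraMap (R p) (Kalg p)).comp WittVector.frobenius =
        (φ : Kalg p →+* Kalg p).comp (algebraMap (R p) (Kalg p)) := by
      ext x; exact (hφ x).symm
    rw [this, ← RingHom.coe_coe φ, ← Polynomial.hom_eval₂, ← Polynomial.aeval_def, h0, map_zero]

theorem phi_mem {φ : Kalg p ≃+* Kalg p} (hφ : ExtendsFrobenius φ) {π : Kalg p}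
    (hπ : IsPi π) {x : Kalg p} (hx : x ∈ Rpi π) : φ x ∈ Rpi π := by
  induction hx using Algebra.adjoin_induction with
  | mem x hx => rw [Set.mem_singleton_iff.1 hx]; exact phi_pi_mem hφ hπ
  | algebraMap r => rw [hφ]; exact Subalgebra.algebraMap_mem _ _
  | add x y _ _ h1 h2 => rw [map_add]; exact add_mem h1 h2
  | mul x y _ _ h1 h2 => rw [map_mul]; exact mul_mem h1 h2

/-- The restriction of `φ` to `R_π`. -/
noncomputable def phiPi {φ : Kalg p ≃+* Kalg p} (hφ : ExtendsFrobenius φ) {π : Kalg p}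
    (hπ : IsPi π) : Rpi π →+* Rpi π :=
  ((φ : Kalg p →+* Kalg p).comp (Rpi π).val.toRingHom).codRestrict (Rpi π)
    fun x => phi_mem hφ hπ x.2

/-- `π` as an element of `R_π`. -/
noncomputable def piElt (π : Kalg p) : Rpi π := ⟨π, Algebra.self_mem_adjoin_singleton _ _⟩

theorem exists_add_pi_mul {π : Kalg p} (x : Rpi π) :
    ∃ (a : R p) (y : Rpi π), x = algebraMap (R p) (Rpi π) a + piElt π * y := by
  obtain ⟨x, hx⟩ := x
  have hx' : x ∈ Algebra.adjoin (R p) {π} := hx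
  rw [Algebra.adjoin_singleton_eq_range_aeval] at hx'
  obtain ⟨q, rfl⟩ := hx'
  refine ⟨q.coeff 0, ⟨Polynomial.aeval π q.divX, Polynomial.aeval_mem_adjoin_singleton _ _⟩, ?_⟩
  apply Subtype.ext
  change Polynomial.aeval π q = algebraMap (R p) (Kalg p) (q.coeff 0) +
    π * Polynomial.aeval π q.divX
  conv_lhs => rw [← Polynomial.divX_mul_X_add q]
  simp only [map_add, map_mul, Polynomial.aeval_X, Polynomial.aeval_C]
  ring

theorem isUnit_or_dvd (a : R p) : IsUnit a ∨ (p : R p) ∣ a := by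
  by_cases h : a.coeff 0 = 0
  · right; rwa [← Ideal.mem_span_singleton, WittVector.mem_span_p_iff_coeff_zero_eq_zero]
  · left; exact WittVector.isUnit_of_coeff_zero_ne_zero a h

theorem exists_pi_mul {π : Kalg p} (hπ : IsPi π) : ∃ c : Rpi π, piElt π * c = p := by
  obtain ⟨⟨f, hm, he, -, h0⟩, -⟩ := hπ
  have hp : Prime (p : R p) := (WittVector.irreducible p).prime
  have hd : f.natDegree ≠ 0 := by
    intro h
    rw [Polynomial.Monic.natDegree_eq_zero hm] at h
    simp [h] at h0
  obtain ⟨d, hd'⟩ := Ideal.mem_span_singleton.1 (he.coeff_mem (n := 0) hd.symm)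
  have hu : IsUnit d := by
    refine (isUnit_or_dvd d).resolve_right fun ⟨w, hw⟩ => he.notMem ?_
    rw [Ideal.span_singleton_pow, Ideal.mem_span_singleton]
    exact ⟨w, by rw [hd', hw]; ring⟩
  obtain ⟨v, rfl⟩ := hu
  refine ⟨-(algebraMap (R p) (Rpi π) (v⁻¹ : (R p)ˣ)) *
    ⟨Polynomial.aeval π f.divX, Polynomial.aeval_mem_adjoin_singleton _ _⟩, ?_⟩
  apply Subtype.ext
  change π * (-(algebraMap (R p) (Kalg p) (v⁻¹ : (R p)ˣ)) * Polynomial.aeval π f.divX) = _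
  have h1 : Polynomial.aeval π f.divX * π + algebraMap (R p) (Kalg p) (p * v) = 0 := by
    rw [← h0, ← hd']
    conv_rhs => rw [← Polynomial.divX_mul_X_add f]
    simp
  have h2 : π * Polynomial.aeval π f.divX = - algebraMap (R p) (Kalg p) (p * v) := by
    rw [mul_comm]; exact eq_neg_of_add_eq_zero_left h1
  calc _ = - algebraMap (R p) (Kalg p) (v⁻¹ : (R p)ˣ) * (π * Polynomial.aeval π f.divX) := by ring
    _ = algebraMap (R p) (Kalg p) (p * (v * (v⁻¹ : (R p)ˣ))) := by
      rw [h2]; simp only [map_mul]; ring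
    _ = _ := by rw [Units.mul_inv, mul_one, map_natCast]; rfl

theorem exists_pi_pow {π : Kalg p} (hπ : IsPi π) :
    ∃ (n : ℕ) (w : Rpi π), piElt π ^ n = p * w := by
  obtain ⟨⟨f, hm, he, -, h0⟩, -⟩ := hπ
  have h := he.isWeaklyEisensteinAt.exists_mem_adjoin_mul_eq_pow_natDegree h0 hm
  obtain ⟨y, hy, h⟩ := h
  refine ⟨(f.map (algebraMap (R p) (Kalg p))).natDegree, ⟨y, hy⟩, Subtype.ext ?_⟩
  change π ^ _ = ((p : Rpi π) : Kalg p) * y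
  rw [← h, map_natCast]; rfl

theorem not_isUnit_pi {π : Kalg p} (hπ : IsPi π) : ¬ IsUnit (piElt π) := by
  intro hu
  obtain ⟨n, w, h⟩ := exists_pi_pow hπ
  have h1 : IsUnit (algebraMap (R p) (Rpi π) p) := by
    rw [map_natCast]; exact isUnit_of_mul_isUnit_left (h ▸ hu.pow n)
  have hint : (algebraMap (R p) (Rpi π)).IsIntegral :=
    (Algebra.IsIntegral.adjoin (fun x hx => by
      rw [Set.mem_singleton_iff.1 hx]; exact isIntegral_pi hπ)).isIntegral
  have := hint.isLocalHom (fun x y hxy => algebraMap_R_injective (congrArg Subtype.val hxy))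
  exact (WittVector.irreducible (k := AlgebraicClosure (ZMod p)) p).not_isUnit
    (isUnit_of_map_unit _ _ h1)

theorem pi_dvd_phi_sub {φ : Kalg p ≃+* Kalg p} (hφ : ExtendsFrobenius φ) {π : Kalg p}
    (hπ : IsPi π) (x : Rpi π) : piElt π ∣ phiPi hφ hπ x - x ^ p := by
  have hp0 : p ≠ 0 := (Fact.out : p.Prime).ne_zero
  have hpp : piElt π ∣ (p : Rpi π) := by
    obtain ⟨c, hc⟩ := exists_pi_mul hπ; exact ⟨c, hc.symm⟩
  have hR (a : R p) : phiPi hφ hπ (algebraMap (R p) (Rpi π) a) =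
      algebraMap (R p) (Rpi π) (WittVector.frobenius a) := Subtype.ext (hφ a)
  have hbase : piElt π ∣ phiPi hφ hπ (piElt π) := by
    obtain ⟨a, y, h⟩ := exists_add_pi_mul (phiPi hφ hπ (piElt π))
    have ha : ¬ IsUnit a := by
      intro hu
      obtain ⟨n, w, hw⟩ := exists_pi_pow hπ
      have h1 : piElt π ∣ (phiPi hφ hπ (piElt π)) ^ n := by
        rw [← map_pow, hw, map_mul, map_natCast]; exact hpp.mul_right _
      have h2 : piElt π ∣ (phiPi hφ hπ (piElt π)) ^ n - algebraMap (R p) (Rpi π) a ^ n :=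
        (show piElt π ∣ phiPi hφ hπ (piElt π) - algebraMap (R p) (Rpi π) a from
          ⟨y, by rw [h]; ring⟩).trans (sub_dvd_pow_sub_pow _ _ n)
      have h3 := (dvd_sub_right h1).1 h2
      exact not_isUnit_pi hπ (isUnit_of_dvd_unit h3 ((hu.map _).pow n))
    obtain ⟨b, rfl⟩ := (isUnit_or_dvd a).resolve_left ha
    rw [h, map_mul, map_natCast]
    exact dvd_add (hpp.mul_right _) (dvd_mul_right _ _)
  have key : ∀ a y : Rpi π, piElt π ∣ phiPi hφ hπ a - a ^ p →
      piElt π ∣ phiPi hφ hπ (a + piElt π * y) - (a + piElt π * y) ^ p := by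
    intro a y ha
    have e : phiPi hφ hπ (a + piElt π * y) - (a + piElt π * y) ^ p =
        (phiPi hφ hπ a - a ^ p) + phiPi hφ hπ (piElt π) * phiPi hφ hπ y
          - (piElt π * y) ^ p + p * cPoly p a (piElt π * y) := by
      rw [mul_cPoly, map_add, map_mul]; ring
    rw [e]
    refine dvd_add (dvd_sub (dvd_add ha (hbase.mul_right _)) ?_) (hpp.mul_right _)
    exact (dvd_mul_right _ _).trans (dvd_pow_self _ hp0)
  obtain ⟨a, y, rfl⟩ := exists_add_pi_mul x
  refine key _ _ ?_
  rw [hR, ← map_pow, ← map_sub]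
  obtain ⟨b, hb⟩ := dvd_frobenius_sub a
  rw [hb, map_mul, map_natCast]
  exact hpp.mul_right _

end Base

/-- A ring `O` with a uniformizing element `ϖ` dividing `p` (with quotient `quo = p / ϖ`), an
endomorphism `φ` lifting the `p`-power map modulo `ϖ`, and the Fermat quotient operator
`δ x = (φ x - x ^ p) / ϖ`. -/
structure FrobeniusBase (p : ℕ) (O : Type*) [CommRing O] where
  ϖ : O
  quo : O
  φ : O →+* O
  δ : O → O
  ϖ_mul_quo : ϖ * quo = p
  φ_eq : ∀ x, φ x = x ^ p + ϖ * δ x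

/-- The ring `R` with `ϖ = p`, its Frobenius, and `δ = δ_p`. -/
noncomputable def baseR (p : ℕ) [Fact p.Prime] : FrobeniusBase p (R p) where
  ϖ := p
  quo := 1
  φ := WittVector.frobenius
  δ x := (dvd_frobenius_sub x).choose
  ϖ_mul_quo := mul_one _
  φ_eq x := by rw [← (dvd_frobenius_sub x).choose_spec]; ring

/-- The ring `R_π` with `ϖ = π`, the restriction of `φ`, and `δ = δ_π`. -/
noncomputable def baseRpi {p : ℕ} [Fact p.Prime] {φ : Kalg p ≃+* Kalg p} (hφ : ExtendsFrobenius φ) {π : Kalg p}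
    (hπ : IsPi π) : FrobeniusBase p (Rpi π) where
  ϖ := piElt π
  quo := (exists_pi_mul hπ).choose
  φ := phiPi hφ hπ
  δ x := (pi_dvd_phi_sub hφ hπ x).choose
  ϖ_mul_quo := (exists_pi_mul hπ).choose_spec
  φ_eq x := by rw [← (pi_dvd_phi_sub hφ hπ x).choose_spec]; ring



section Prolongation

variable {p : ℕ} {O : Type} [CommRing O]

/-- `δ` is a `π`-derivation along `f`; the polynomial `C_π` is `(p / π) C_p`. -/
structure IsPiDerivation (F : FrobeniusBase p O) {A B : Type*} [CommRing A] [CommRing B]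
    [Algebra O A] [Algebra O B] (f : A →ₐ[O] B) (δ : A → B) : Prop where
  map_one : δ 1 = 0
  map_add : ∀ x y, δ (x + y) = δ x + δ y + algebraMap O B F.quo * cPoly p (f x) (f y)
  map_mul : ∀ x y, δ (x * y) =
    f x ^ p * δ y + f y ^ p * δ x + algebraMap O B F.ϖ * δ x * δ y

/-- A prolongation sequence over the base `O`: algebras `S^r`, algebra maps `S^r → S^{r+1}`, and
`π`-derivations `S^r → S^{r+1}` compatible with them and with `δ` on `O`. -/
structure ProlSeq (F : FrobeniusBase p O) where
  obj : ℕ → Type u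
  [ring : ∀ r, CommRing (obj r)]
  [alg : ∀ r, Algebra O (obj r)]
  incl : ∀ r, obj r →ₐ[O] obj (r + 1)
  δ : ∀ r, obj r → obj (r + 1)
  isPiDerivation : ∀ r, IsPiDerivation F (incl r) (δ r)
  δ_incl : ∀ r x, δ (r + 1) (incl r x) = incl (r + 1) (δ r x)
  δ_base : ∀ r x, δ r (algebraMap O (obj r) x) = algebraMap O (obj (r + 1)) (F.δ x)

namespace ProlSeq

attribute [instance] ProlSeq.ring ProlSeq.alg

variable {F : FrobeniusBase p O}

/-- Morphisms of prolongation sequences over `O`. -/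
structure Hom (S S' : ProlSeq.{u} F) where
  map : ∀ r, S.obj r →ₐ[O] S'.obj r
  map_incl : ∀ r x, map (r + 1) (S.incl r x) = S'.incl r (map r x)
  map_δ : ∀ r x, map (r + 1) (S.δ r x) = S'.δ r (map r x)

/-- The category `Prol`: every `S^r` is Noetherian, `p`-adically complete and flat over `O`. -/
structure InProl (S : ProlSeq.{u} F) : Prop where
  noetherian : ∀ r, IsNoetherianRing (S.obj r)
  complete : ∀ r, IsAdicComplete (Ideal.span {(p : S.obj r)}) (S.obj r)
  flat : ∀ r, Module.Flat O (S.obj r)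

/-- `S`, together with `ι : A → S^0`, is the sequence `(𝒪(J^r(Spec A)))_r` of rings of functions on
the jet spaces of `Spec A` over `O`: it lies in `Prol`, `ι` exhibits `S^0` as the `p`-adic
completion of `A`, and it is universal among the prolongation sequences in `Prol`
whose `0`-th ring receives a homomorphism from `A`. -/
structure IsJet {A : Type u} [CommRing A] [Algebra O A] (S : ProlSeq.{u} F)
    (ι : A →ₐ[O] S.obj 0) : Prop where
  inProl : S.InProl
  completion_injective : ∀ (n : ℕ) (a : A), (p : S.obj 0) ^ n ∣ ι a → (p : A) ^ n ∣ a
  completion_surjective : ∀ (n : ℕ) (s : S.obj 0), ∃ a : A, (p : S.obj 0) ^ n ∣ s - ι a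
  universal : ∀ (B : ProlSeq.{u} F), B.InProl → ∀ v : A →ₐ[O] B.obj 0,
    ∃! w : Hom S B, ∀ a, w.map 0 (ι a) = v a

variable [Fact p.Prime]

/-- The ring homomorphism `φ(x) = x ^ p + π δ x`. -/
def phi (S : ProlSeq.{u} F) (r : ℕ) : S.obj r →+* S.obj (r + 1) where
  toFun x := S.incl r x ^ p + algebraMap O _ F.ϖ * S.δ r x
  map_one' := by simp [(S.isPiDerivation r).map_one]
  map_mul' x y := by rw [(S.isPiDerivation r).map_mul, map_mul]; ring
  map_zero' := by
    have h := (S.isPiDerivation r).map_add 0 0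
    have hc : cPoly p (S.incl r 0) (S.incl r 0) = 0 := by
      rw [cPoly, neg_eq_zero]
      refine Finset.sum_eq_zero fun i hi => ?_
      rw [Finset.mem_Ico] at hi
      rw [map_zero, zero_pow (by omega : i ≠ 0), mul_zero, zero_mul]
    rw [hc, add_zero, mul_zero, add_zero] at h
    have h' : S.δ r 0 = 0 := by simpa using h
    rw [h', map_zero, mul_zero, add_zero, zero_pow (Fact.out : p.Prime).ne_zero]
  map_add' x y := by
    have h : algebraMap O (S.obj (r + 1)) F.ϖ * algebraMap O (S.obj (r + 1)) F.quo = p := by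
      rw [← map_mul, F.ϖ_mul_quo, map_natCast]
    have h2 := mul_cPoly p (S.incl r x) (S.incl r y)
    rw [(S.isPiDerivation r).map_add, map_add]
    linear_combination h2 + cPoly p (S.incl r x) (S.incl r y) * h

/-- The `r`-fold iterate `φ^r : S^0 → S^r`. -/
def phiIter (S : ProlSeq.{u} F) : ∀ r, S.obj 0 →+* S.obj r
  | 0 => RingHom.id _
  | r + 1 => (S.phi r).comp (phiIter S r)

theorem phi_base (S : ProlSeq.{u} F) (r : ℕ) (x : O) :
    S.phi r (algebraMap O _ x) = algebraMap O _ (F.φ x) := by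
  change S.incl r _ ^ p + _ * S.δ r _ = _
  rw [S.δ_base, F.φ_eq, AlgHom.commutes]
  simp

end ProlSeq

/-- Compatibility of the data on `O'` with those on `O`: `O'` extends `O` together with `φ`, and
`ϖ'` is a non-zero-divisor dividing `ϖ`. -/
structure FrobeniusBase.Extends (F : FrobeniusBase p O) {O' : Type} [CommRing O'] [Algebra O O']
    (F' : FrobeniusBase p O') : Prop where
  φ_algebraMap : ∀ x, F'.φ (algebraMap O O' x) = algebraMap O O' (F.φ x)
  ϖ_mem : F'.ϖ ∈ nonZeroDivisors O'
  ϖ_dvd : F'.ϖ ∣ algebraMap O O' F.ϖ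

namespace ProlSeq

variable [Fact p.Prime] {F : FrobeniusBase p O} {O' : Type} [CommRing O'] [Algebra O O']
  {F' : FrobeniusBase p O'}

/-- The ring homomorphism `φ ⊗ φ : O' ⊗ S^r → O' ⊗ S^{r+1}`. -/
noncomputable def baseChangePhi (S : ProlSeq.{u} F) (h : F.Extends F') (r : ℕ) :
    O' ⊗[O] S.obj r →+* O' ⊗[O] S.obj (r + 1) :=
  let f : O' ⊗[O] S.obj r →+ O' ⊗[O] S.obj (r + 1) :=
    TensorProduct.liftAddHom
      { toFun := fun y =>
          { toFun := fun x => F'.φ y ⊗ₜ[O] S.phi r x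
            map_zero' := by simp
            map_add' := fun x x' => by rw [map_add, TensorProduct.tmul_add] }
        map_zero' := by ext; simp
        map_add' := fun y y' => by ext x; simp [TensorProduct.add_tmul] }
      fun c y x => by
        simp only [AddMonoidHom.coe_mk, ZeroHom.coe_mk, Algebra.smul_def, map_mul,
          h.φ_algebraMap, phi_base]
        rw [← Algebra.smul_def, ← Algebra.smul_def, TensorProduct.smul_tmul]
  { f with
    map_one' := by
      change F'.φ 1 ⊗ₜ[O] S.phi r 1 = 1
      rw [map_one, map_one]; rfl
    map_mul' := fun z w => by
      change f (z * w) = f z * f w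
      induction z with
      | zero => simp
      | add a b ha hb => rw [add_mul, map_add, map_add, ha, hb, add_mul]
      | tmul y x =>
        induction w with
        | zero => simp
        | add a b ha hb => rw [mul_add, map_add, map_add, ha, hb, mul_add]
        | tmul y' x' =>
          rw [Algebra.TensorProduct.tmul_mul_tmul]
          change F'.φ (y * y') ⊗ₜ[O] S.phi r (x * x') =
            (F'.φ y ⊗ₜ[O] S.phi r x) * (F'.φ y' ⊗ₜ[O] S.phi r x')
          rw [Algebra.TensorProduct.tmul_mul_tmul, map_mul, map_mul] }

theorem baseChangePhi_tmul (S : ProlSeq.{u} F) (h : F.Extends F') (r : ℕ) (y : O')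
    (x : S.obj r) : S.baseChangePhi h r (y ⊗ₜ x) = F'.φ y ⊗ₜ S.phi r x := rfl

/-- The map `S^r → S^{r+1}` after base change. -/
noncomputable abbrev baseChangeIncl (S : ProlSeq.{u} F) (O' : Type) [CommRing O'] [Algebra O O']
    (r : ℕ) : O' ⊗[O] S.obj r →ₐ[O'] O' ⊗[O] S.obj (r + 1) :=
  Algebra.TensorProduct.map (AlgHom.id O' O') (S.incl r)

theorem baseChange_dvd (S : ProlSeq.{u} F) (h : F.Extends F') (r : ℕ) (z : O' ⊗[O] S.obj r) :
    algebraMap O' _ F'.ϖ ∣ S.baseChangePhi h r z - S.baseChangeIncl O' r z ^ p := by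
  have hp0 : p ≠ 0 := (Fact.out : p.Prime).ne_zero
  induction z with
  | zero => simp [hp0]
  | add a b ha hb =>
    have e : S.baseChangePhi h r (a + b) - S.baseChangeIncl O' r (a + b) ^ p =
        (S.baseChangePhi h r a - S.baseChangeIncl O' r a ^ p) +
        (S.baseChangePhi h r b - S.baseChangeIncl O' r b ^ p) +
        p * cPoly p (S.baseChangeIncl O' r a) (S.baseChangeIncl O' r b) := by
      rw [mul_cPoly, map_add, map_add]; ring
    rw [e]
    refine dvd_add (dvd_add ha hb) (Dvd.dvd.mul_right ?_ _)
    exact ⟨algebraMap O' _ F'.quo, by rw [← map_mul, F'.ϖ_mul_quo, map_natCast]⟩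
  | tmul y x =>
    obtain ⟨d, hd⟩ := h.ϖ_dvd
    have e : S.baseChangePhi h r (y ⊗ₜ x) - S.baseChangeIncl O' r (y ⊗ₜ x) ^ p =
        algebraMap O' _ F'.ϖ * (F'.δ y ⊗ₜ S.phi r x + (y ^ p * d) ⊗ₜ S.δ r x) := by
      rw [baseChangePhi_tmul, Algebra.TensorProduct.map_tmul, Algebra.TensorProduct.tmul_pow,
        AlgHom.id_apply, ← Algebra.smul_def, smul_add, TensorProduct.smul_tmul',
        TensorProduct.smul_tmul', smul_eq_mul, smul_eq_mul]
      have e1 : F'.φ y = y ^ p + F'.ϖ * F'.δ y := F'.φ_eq y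
      have e2 : S.phi r x = S.incl r x ^ p + algebraMap O _ F.ϖ * S.δ r x := rfl
      have e3 : (F'.ϖ * (y ^ p * d)) ⊗ₜ[O] S.δ r x =
          (y ^ p) ⊗ₜ[O] (algebraMap O _ F.ϖ * S.δ r x) := by
        rw [← Algebra.smul_def F.ϖ (S.δ r x), ← TensorProduct.smul_tmul,
          Algebra.smul_def F.ϖ (y ^ p), hd]
        congr 1; ring
      rw [e1, TensorProduct.add_tmul, e3]
      nth_rw 1 [e2]
      rw [TensorProduct.tmul_add]
      abel
    exact ⟨_, e⟩

theorem baseChange_cancel (S : ProlSeq.{u} F) (h : F.Extends F') (r : ℕ)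
    (hS : Module.Flat O (S.obj r)) {a b : O' ⊗[O] S.obj r}
    (hab : algebraMap O' _ F'.ϖ * a = algebraMap O' _ F'.ϖ * b) : a = b := by
  have : Module.Flat O' (O' ⊗[O] S.obj r) := inferInstance
  refine Module.Flat.isSMulRegular_of_nonZeroDivisors (M := O' ⊗[O] S.obj r) h.ϖ_mem ?_
  simpa only [Algebra.smul_def] using hab

/-- The prolongation sequence `S^* ⊗ O'` over `O'`, for `S^*` flat over `O`: the operator is
`δ z = (φ z - z ^ p) / ϖ'` with `φ = φ ⊗ φ`. -/
noncomputable def baseChange (S : ProlSeq.{u} F) (h : F.Extends F')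
    (hS : ∀ r, Module.Flat O (S.obj r)) : ProlSeq.{u} F' where
  obj r := O' ⊗[O] S.obj r
  incl r := S.baseChangeIncl O' r
  δ r z := (S.baseChange_dvd h r z).choose
  isPiDerivation r := by
    have H (z) := (S.baseChange_dvd h r z).choose_spec
    refine ⟨?_, fun x y => ?_, fun x y => ?_⟩ <;>
      refine S.baseChange_cancel h (r + 1) (hS _) ?_
    · rw [← H]; simp
    · have hq : algebraMap O' (O' ⊗[O] S.obj (r + 1)) F'.ϖ * algebraMap O' _ F'.quo = p := by
        rw [← map_mul, F'.ϖ_mul_quo, map_natCast]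
      have h2 := mul_cPoly p (S.baseChangeIncl O' r x) (S.baseChangeIncl O' r y)
      have H1 := H x
      have H2 := H y
      rw [← H, map_add, map_add]
      linear_combination H1 + H2 - h2 -
        cPoly p (S.baseChangeIncl O' r x) (S.baseChangeIncl O' r y) * hq
    · have H1 := H x
      have H2 := H y
      rw [← H, map_mul, map_mul]
      linear_combination S.baseChangePhi h r y * H1 + (S.baseChangeIncl O' r x ^ p +
        algebraMap O' _ F'.ϖ * (S.baseChange_dvd h r x).choose) * H2
  δ_incl r x := by
    refine S.baseChange_cancel h (r + 2) (hS _) ?_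
    rw [← (S.baseChange_dvd h (r + 1) _).choose_spec]
    have H := congrArg (S.baseChangeIncl O' (r + 1)) (S.baseChange_dvd h r x).choose_spec
    rw [map_mul, AlgHom.commutes] at H
    rw [← H, map_sub, map_pow]
    congr 1
    clear H
    induction x with
    | zero => simp
    | add a b ha hb => simp only [map_add, ha, hb]
    | tmul y x =>
      simp only [Algebra.TensorProduct.map_tmul, baseChangePhi_tmul, AlgHom.id_apply]
      congr 1
      change S.incl (r + 1) _ ^ p + algebraMap O _ F.ϖ * S.δ (r + 1) _ =
        S.incl (r + 1) (S.incl r x ^ p + algebraMap O _ F.ϖ * S.δ r x)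
      rw [S.δ_incl, map_add, map_mul, map_pow, AlgHom.commutes]
  δ_base r x := by
    refine S.baseChange_cancel h (r + 1) (hS _) ?_
    rw [← (S.baseChange_dvd h r _).choose_spec, AlgHom.commutes,
      Algebra.TensorProduct.algebraMap_apply, baseChangePhi_tmul, map_one]
    have : F'.φ x ⊗ₜ[O] (1 : S.obj (r + 1)) =
      algebraMap O' (O' ⊗[O] S.obj (r + 1)) (F'.φ x) := rfl
    rw [Algebra.algebraMap_self, RingHom.id_apply, this, F'.φ_eq, map_add, map_mul, map_pow]
    simp

end ProlSeq
end Prolongation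

theorem baseR_extends {p : ℕ} [Fact p.Prime] {φ : Kalg p ≃+* Kalg p} (hφ : ExtendsFrobenius φ)
    {π : Kalg p} (hπ : IsPi π) : (baseR p).Extends (baseRpi hφ hπ) where
  φ_algebraMap a := Subtype.ext (hφ a)
  ϖ_mem := by
    refine mem_nonZeroDivisors_of_ne_zero fun h0 => ?_
    obtain ⟨c, hc⟩ := exists_pi_mul hπ
    change piElt π = 0 at h0
    rw [h0, zero_mul] at hc
    have h1 : algebraMap (R p) (Kalg p) p = algebraMap (R p) (Kalg p) 0 := by
      rw [map_zero, map_natCast]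
      exact (congrArg Subtype.val hc).symm
    exact (WittVector.irreducible (k := AlgebraicClosure (ZMod p)) p).ne_zero
      (algebraMap_R_injective h1)
  ϖ_dvd := by
    obtain ⟨c, hc⟩ := exists_pi_mul hπ
    exact ⟨c, by change algebraMap _ _ (p : R p) = piElt π * c; rw [hc, map_natCast]⟩

section FormalGroups

open MvPowerSeries in
/-- A commutative formal group law in `g` variables over `B`. -/
structure FormalGroupLaw (g : ℕ) (B : Type*) [CommRing B] where
  series : Fin g → MvPowerSeries (Fin g ⊕ Fin g) B
  add_zero : ∀ k, subst (Sum.elim X fun _ => 0 : Fin g ⊕ Fin g → MvPowerSeries (Fin g) B)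
    (series k) = X k
  zero_add : ∀ k, subst (Sum.elim (fun _ => 0) X : Fin g ⊕ Fin g → MvPowerSeries (Fin g) B)
    (series k) = X k
  assoc : ∀ k,
    subst (Sum.elim
      (fun i => subst (Sum.elim (fun j => X (Sum.inl j)) (fun j => X (Sum.inr (Sum.inl j))))
        (series i))
      (fun i => X (Sum.inr (Sum.inr i))) :
        Fin g ⊕ Fin g → MvPowerSeries (Fin g ⊕ Fin g ⊕ Fin g) B) (series k) =
    subst (Sum.elim
      (fun i => X (Sum.inl i))
      (fun i => subst (Sum.elim (fun j => X (Sum.inr (Sum.inl j)))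
        (fun j => X (Sum.inr (Sum.inr j)))) (series i)) :
        Fin g ⊕ Fin g → MvPowerSeries (Fin g ⊕ Fin g ⊕ Fin g) B) (series k)
  comm : ∀ k, subst (Sum.elim (fun j => X (Sum.inr j)) (fun j => X (Sum.inl j)) :
    Fin g ⊕ Fin g → MvPowerSeries (Fin g ⊕ Fin g) B) (series k) = series k

open MvPowerSeries in
/-- `l` is the logarithm of `𝓕`: the (unique) `g`-tuple of series over `B ⊗ ℚ` with
`l(T) ≡ T` modulo terms of degree `≥ 2` and `l(𝓕(T₁, T₂)) = l(T₁) + l(T₂)`. -/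
structure FormalGroupLaw.IsLogarithm {g : ℕ} {B : Type*} [CommRing B] (𝓕 : FormalGroupLaw g B)
    (l : Fin g → MvPowerSeries (Fin g) (ℚ ⊗[ℤ] B)) : Prop where
  constantCoeff_eq : ∀ k, constantCoeff (l k) = 0
  linear_eq : ∀ k j, coeff (Finsupp.single j 1) (l k) = if j = k then 1 else 0
  map_add : ∀ k,
    subst (fun i => MvPowerSeries.map
      (Algebra.TensorProduct.includeRight : B →ₐ[ℤ] ℚ ⊗[ℤ] B).toRingHom (𝓕.series i)) (l k) =
    subst (fun i => (X (Sum.inl i) : MvPowerSeries (Fin g ⊕ Fin g) (ℚ ⊗[ℤ] B))) (l k) +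
    subst (fun i => (X (Sum.inr i) : MvPowerSeries (Fin g ⊕ Fin g) (ℚ ⊗[ℤ] B))) (l k)

end FormalGroups

section Jets

/-- On polynomials in variables `(j, k)`, standing for `δ^j T_k`: the homomorphism `φ` that is `θ`
on coefficients and satisfies `φ(δ^j T_k) = (δ^j T_k) ^ p + p δ^{j+1} T_k`. -/
noncomputable def phiPoly (p g : ℕ) {O : Type*} [CommRing O] (θ : O →+* O) :
    MvPolynomial (ℕ × Fin g) O →+* MvPolynomial (ℕ × Fin g) O :=
  MvPolynomial.eval₂Hom (MvPolynomial.C.comp θ)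
    fun jk => MvPolynomial.X jk ^ p + (p : MvPolynomial (ℕ × Fin g) O) *
      MvPolynomial.X (jk.1 + 1, jk.2)

theorem phiPoly_dvd {p : ℕ} [Fact p.Prime] (g : ℕ) {O : Type*} [CommRing O]
    (F : FrobeniusBase p O) (z : MvPolynomial (ℕ × Fin g) O) :
    MvPolynomial.C F.ϖ ∣ phiPoly p g F.φ z - z ^ p := by
  have hpp : MvPolynomial.C F.ϖ ∣ (p : MvPolynomial (ℕ × Fin g) O) :=
    ⟨MvPolynomial.C F.quo, by rw [← map_mul, F.ϖ_mul_quo, map_natCast]⟩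
  induction z using MvPolynomial.induction_on with
  | C a =>
    refine ⟨MvPolynomial.C (F.δ a), ?_⟩
    simp [phiPoly, F.φ_eq]
  | add a b ha hb =>
    have e : phiPoly p g F.φ (a + b) - (a + b) ^ p = (phiPoly p g F.φ a - a ^ p) +
        (phiPoly p g F.φ b - b ^ p) + p * cPoly p a b := by
      rw [mul_cPoly, map_add]; ring
    rw [e]
    exact dvd_add (dvd_add ha hb) (hpp.mul_right _)
  | mul_X a n ha =>
    have e : phiPoly p g F.φ (a * MvPolynomial.X n) - (a * MvPolynomial.X n) ^ p =
        (phiPoly p g F.φ a - a ^ p) * MvPolynomial.X n ^ p +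
          (p : MvPolynomial (ℕ × Fin g) O) * (phiPoly p g F.φ a * MvPolynomial.X (n.1 + 1, n.2)) := by
      have hX : phiPoly p g F.φ (MvPolynomial.X n) = MvPolynomial.X n ^ p +
          (p : MvPolynomial (ℕ × Fin g) O) * MvPolynomial.X (n.1 + 1, n.2) := by
        simp only [phiPoly, MvPolynomial.coe_eval₂Hom, MvPolynomial.eval₂_X]
      rw [map_mul, hX]
      ring
    rw [e]
    exact dvd_add (ha.mul_right _) (hpp.mul_right _)

/-- `δ_π^i T_k` as a polynomial over `R_π` in the `δ^j T_k`:
`δ_π^{i+1} T_k = (φ(δ_π^i T_k) - (δ_π^i T_k) ^ p) / π`. -/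
noncomputable def deltaPoly {p : ℕ} [Fact p.Prime] (g : ℕ) {O : Type*} [CommRing O]
    (F : FrobeniusBase p O) : ℕ → Fin g → MvPolynomial (ℕ × Fin g) O
  | 0, k => MvPolynomial.X (0, k)
  | i + 1, k => (phiPoly_dvd g F (deltaPoly g F i k)).choose

/-- The substitution `T = 0`: the pair `(j, k)`, standing for `δ^j T_k`, goes to `0` for `j = 0`
and to the variable `(j - 1, k)` for `1 ≤ j ≤ r`. The variable `(i, k) : Fin r × Fin g`
thus stands for `δ^{i+1} T_k`. (The value at `j > r` is never used.) -/
noncomputable def atZero (r g : ℕ) (B : Type*) [CommRing B] (jk : ℕ × Fin g) :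
    MvPolynomial (Fin r × Fin g) B :=
  if h : 1 ≤ jk.1 ∧ jk.1 ≤ r then MvPolynomial.X (⟨jk.1 - 1, by omega⟩, jk.2) else 0

/-- The `p`-adic completion `B[δT, …, δ^r T]^`. -/
abbrev JetRing (p r g : ℕ) (B : Type*) [CommRing B] : Type _ :=
  AdicCompletion (Ideal.span {(p : MvPolynomial (Fin r × Fin g) B)})
    (MvPolynomial (Fin r × Fin g) B)

/-- The canonical homomorphism `B[δT, …, δ^r T] → B[δT, …, δ^r T]^`. -/
noncomputable def toJetRing (p r g : ℕ) (B : Type*) [CommRing B] :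
    MvPolynomial (Fin r × Fin g) B →+* JetRing p r g B :=
  algebraMap _ _

/-- The element `x` of `B[δT, …, δ^r T]^` has the expansion `f ∈ (B ⊗ ℚ)[[δT, …, δ^r T]]`: for
every `n` both agree modulo `p ^ n` with one and the same polynomial over `B`. -/
def HasExpansion {p r g : ℕ} {B : Type*} [CommRing B] (x : JetRing p r g B)
    (f : MvPowerSeries (Fin r × Fin g) (ℚ ⊗[ℤ] B)) : Prop :=
  ∀ n : ℕ, ∃ P : MvPolynomial (Fin r × Fin g) B,
    AdicCompletion.evalₐ _ n x = Ideal.Quotient.mk _ P ∧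
    ∀ β, ∃ b : B, MvPowerSeries.coeff β f = 1 ⊗ₜ[ℤ] (MvPolynomial.coeff β P + (p : B) ^ n * b)

/-- `L^r_k = (1 / p) {φ^r(l_k(T))}|_{T = 0} ∈ (S^r ⊗ ℚ)[[δT, …, δ^r T]]`: apply `φ^r` to the
coefficients of `l_k` and substitute `φ^r(T)|_{T = 0}` for `T`. -/
noncomputable def jetLog {p : ℕ} [Fact p.Prime] {O : Type} [CommRing O] {F : FrobeniusBase p O}
    (S : ProlSeq.{u} F) {g : ℕ} (l : Fin g → MvPowerSeries (Fin g) (ℚ ⊗[ℤ] S.obj 0)) (r : ℕ)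
    (k : Fin g) : MvPowerSeries (Fin r × Fin g) (ℚ ⊗[ℤ] S.obj r) :=
  (p : ℚ)⁻¹ • MvPowerSeries.subst
    (fun i => ((MvPolynomial.aeval (atZero r g (ℚ ⊗[ℤ] S.obj r))
      ((phiPoly p g (RingHom.id ℤ))^[r] (MvPolynomial.X (0, i))) :
        MvPolynomial (Fin r × Fin g) (ℚ ⊗[ℤ] S.obj r)) :
          MvPowerSeries (Fin r × Fin g) (ℚ ⊗[ℤ] S.obj r)))
    (MvPowerSeries.map
      (Algebra.TensorProduct.map (AlgHom.id ℤ ℚ) (S.phiIter r).toIntAlgHom).toRingHom (l k))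

variable {p : ℕ} [Fact p.Prime] {O : Type} [CommRing O] {F : FrobeniusBase p O}
  {O' : Type} [CommRing O'] [Algebra O O'] {F' : FrobeniusBase p O'}

/-- `Ψ` is the natural homomorphism
`S_π^r[δ_π T, …, δ_π^r T]^ → R_π ⊗ S^r[δT, …, δ^r T]^`. On `S_π^r` it is the `r`-th
component of the morphism of prolongation sequences `S_π^* → R_π ⊗ S^*` that extends `ι`,
and it sends `δ_π^i T_k` to the value at `T = 0` of its expression through `T, δT, …, δ^i T`. -/
def IsNaturalMap {A : Type u} [CommRing A] [Algebra O A] (S : ProlSeq.{u} F)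
    (ι : A →ₐ[O] S.obj 0) (h : F.Extends F') (hS : ∀ r, Module.Flat O (S.obj r))
    (Sπ : ProlSeq.{u} F') (ιπ : O' ⊗[O] A →ₐ[O'] Sπ.obj 0) (r g : ℕ)
    (Ψ : JetRing p r g (Sπ.obj r) →+* O' ⊗[O] JetRing p r g (S.obj r)) : Prop :=
  ∃ v : ProlSeq.Hom Sπ (S.baseChange h hS),
    (∀ x, v.map 0 (ιπ x) = Algebra.TensorProduct.map (AlgHom.id O' O') ι x) ∧
    (∀ b, Ψ (toJetRing p r g _ (MvPolynomial.C b)) =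
      Algebra.TensorProduct.map (AlgHom.id O' O')
        (IsScalarTower.toAlgHom O (S.obj r) (JetRing p r g (S.obj r))) (v.map r b)) ∧
    ∀ (i : Fin r) (k : Fin g), Ψ (toJetRing p r g _ (MvPolynomial.X (i, k))) =
      MvPolynomial.aeval (fun jk => 1 ⊗ₜ[O] toJetRing p r g (S.obj r) (atZero r g _ jk))
        (deltaPoly g F' (i + 1) k)

end Jets

end PiJet

open PiJet

/-!
Since the invariant differentials of a formal group law are integral, so are the partial
derivatives of `l_k`; hence `l_k = ∑_α (b_α / p ^ ⌊log_p |α|⌋) T ^ α` with integral `b_α`. At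
`T = 0` one has `φ^r(T_i) = p P_i`, so that `L^r_k = ∑_α p ^ (|α| - 1 - ⌊log_p |α|⌋) φ^r(b_α) P ^ α`
converges `p`-adically. In terms of the `δ_π^j T_i` one has `φ^r(T_i) = T_i ^ (p ^ r) + π q_i`, and
`q_i` gives `Q_i` with `p P_i = π Ψ(Q_i)`. A lift `b'_α` of `b_α` therefore gives
`p^ν (p ^ (|α| - 1 - ⌊log_p |α|⌋) φ^r(b_α) P ^ α) = Ψ(d_α φ^r(b'_α) Q ^ α)`, where
`d_α = p ^ (⌊log_p e⌋ + 1 - ⌊log_p |α|⌋) π ^ |α|`. As `p ∣ π ^ e`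
and `⌊log_p n⌋ ≤ ⌊log_p e⌋ + 1 + ⌊n / e⌋`, the element `d_α` is integral and divisible by
`p ^ (⌊|α| / e⌋ - ⌊log_p |α|⌋)`, so the preimages can be summed as well.
-/

namespace PiJet

section ChainRule

open MvPowerSeries

variable {σ τ R : Type*} [CommRing R]

open scoped MvPowerSeries.WithPiTopology in
theorem continuous_pderiv [TopologicalSpace R] [ContinuousMul R] (j : σ) :
    Continuous (pderiv R j : MvPowerSeries σ R → MvPowerSeries σ R) := by
  refine continuous_pi fun d => ?_
  change Continuous fun f => coeff d (pderiv R j f)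
  simp only [coeff_pderiv]
  exact (WithPiTopology.continuous_coeff R _).mul_const _

theorem pderiv_subst_coe [Fintype σ] {a : σ → MvPowerSeries τ R} (hs : HasSubst a) (j : τ)
    (q : MvPolynomial σ R) :
    pderiv R j (subst a (q : MvPowerSeries σ R)) =
      ∑ i, subst a (pderiv R i (q : MvPowerSeries σ R)) * pderiv R j (a i) := by
  classical
  induction q using MvPolynomial.induction_on with
  | C r =>
    have h0 : subst a (0 : MvPowerSeries σ R) = 0 := by rw [← coe_substAlgHom hs, map_zero]
    simp only [MvPolynomial.coe_C, subst_C, pderiv_C, h0, zero_mul, Finset.sum_const_zero]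
  | add q q' h h' =>
    simp only [MvPolynomial.coe_add, subst_add hs, map_add, h, h', add_mul, Finset.sum_add_distrib]
  | mul_X q n h =>
    have hX (i : σ) : subst a (pderiv R i (X n : MvPowerSeries σ R)) = if n = i then 1 else 0 := by
      rw [← coe_substAlgHom hs]
      split_ifs with hi
      · rw [hi, pderiv_X_self, map_one]
      · rw [pderiv_X_of_ne hi, map_zero]
    simp only [MvPolynomial.coe_mul, MvPolynomial.coe_X, subst_mul hs, subst_X hs,
      Derivation.leibniz, subst_add hs, smul_eq_mul, h, hX, add_mul, Finset.sum_add_distrib,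
      Finset.mul_sum]
    congr 1
    · simp
    · exact Finset.sum_congr rfl fun i _ => by ring

open scoped MvPowerSeries.WithPiTopology in
theorem pderiv_subst [Fintype σ] {a : σ → MvPowerSeries τ R} (hs : HasSubst a) (j : τ)
    (f : MvPowerSeries σ R) :
    pderiv R j (subst a f) = ∑ i, subst a (pderiv R i f) * pderiv R j (a i) := by
  let : UniformSpace R := ⊥
  have hsubst : Continuous (subst a : MvPowerSeries σ R → MvPowerSeries τ R) := continuous_subst hs
  refine congrFun (WithPiTopology.denseRange_toMvPowerSeries.equalizer
    ((continuous_pderiv j).comp hsubst)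
    (continuous_finsetSum _ fun i _ => (hsubst.comp (continuous_pderiv i)).mul_const _)
    (funext fun q => pderiv_subst_coe hs j q)) f

end ChainRule

section LogarithmDerivatives

open MvPowerSeries

section RightZero

variable {σ τ υ B C : Type*} [CommRing B] [CommRing C]

theorem map_pderiv (θ : B →+* C) (i : υ) (f : MvPowerSeries υ B) :
    MvPowerSeries.map θ (pderiv B i f) = pderiv C i (MvPowerSeries.map θ f) := by
  ext d
  simp [coeff_pderiv]

theorem constantCoeff_elim_X_zero (i : σ ⊕ τ) :
    constantCoeff ((Sum.elim X fun _ => 0 : σ ⊕ τ → MvPowerSeries σ B) i) = 0 := by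
  cases i <;> simp

theorem constantCoeff_elim_zero_X (i : σ ⊕ τ) :
    constantCoeff ((Sum.elim (fun _ => 0) X : σ ⊕ τ → MvPowerSeries τ B) i) = 0 := by
  cases i <;> simp

variable [Finite σ]

theorem constantCoeff_subst_eq {a : σ → MvPowerSeries υ B} (ha : ∀ i, constantCoeff (a i) = 0)
    (f : MvPowerSeries σ B) : constantCoeff (subst a f) = constantCoeff f := by
  have hs := hasSubst_of_constantCoeff_zero ha
  have h := constantCoeff_subst_eq_zero hs ha (f := f - C (constantCoeff f)) (by simp)
  rwa [subst_sub hs, subst_C, map_sub, constantCoeff_C, sub_eq_zero] at h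

variable [Finite τ]

theorem hasSubst_elim_X_zero : HasSubst (Sum.elim X fun _ => 0 : σ ⊕ τ → MvPowerSeries σ B) :=
  hasSubst_of_constantCoeff_zero constantCoeff_elim_X_zero

/-- The substitution `f(X, Y) ↦ f(X, 0)`. -/
noncomputable def rightZero : MvPowerSeries (σ ⊕ τ) B →ₐ[B] MvPowerSeries σ B :=
  substAlgHom hasSubst_elim_X_zero

theorem rightZero_apply (f : MvPowerSeries (σ ⊕ τ) B) :
    rightZero f = subst (Sum.elim X fun _ => 0 : σ ⊕ τ → MvPowerSeries σ B) f :=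
  congrFun (coe_substAlgHom hasSubst_elim_X_zero) f

theorem rightZero_X (i : σ ⊕ τ) :
    rightZero (X i : MvPowerSeries (σ ⊕ τ) B) = Sum.elim X (fun _ => 0) i := by
  rw [rightZero_apply, subst_X hasSubst_elim_X_zero]

theorem constantCoeff_rightZero (f : MvPowerSeries (σ ⊕ τ) B) :
    constantCoeff (rightZero f) = constantCoeff f := by
  rw [rightZero_apply, constantCoeff_subst_eq constantCoeff_elim_X_zero]

theorem map_rightZero (θ : B →+* C) (f : MvPowerSeries (σ ⊕ τ) B) :
    MvPowerSeries.map θ (rightZero f) = rightZero (MvPowerSeries.map θ f) := by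
  have hθ : (fun i => MvPowerSeries.map θ
      ((Sum.elim X fun _ => 0 : σ ⊕ τ → MvPowerSeries σ B) i)) = Sum.elim X fun _ => 0 := by
    ext1 i
    cases i <;> simp
  rw [rightZero_apply, map_subst hasSubst_elim_X_zero, hθ, rightZero_apply]

theorem rightZero_subst {a : υ → MvPowerSeries (σ ⊕ τ) B} (ha : HasSubst a)
    (f : MvPowerSeries υ B) :
    rightZero (subst a f) = subst (fun i => rightZero (a i)) f := by
  simp only [rightZero_apply]
  exact subst_comp_subst_apply ha hasSubst_elim_X_zero f

end RightZero

namespace FormalGroupLaw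

variable {g : ℕ} {B : Type*} [CommRing B]

theorem constantCoeff_series (𝓕 : FormalGroupLaw g B) (k : Fin g) :
    constantCoeff (𝓕.series k) = 0 := by
  rw [← constantCoeff_subst_eq constantCoeff_elim_X_zero, 𝓕.add_zero, constantCoeff_X]

/-- The matrix `(∂F_i / ∂Y_j)(X, 0)` of a formal group law `F(X, Y)`. -/
noncomputable def derivMatrix (𝓕 : FormalGroupLaw g B) :
    Matrix (Fin g) (Fin g) (MvPowerSeries (Fin g) B) :=
  .of fun i j => rightZero (pderiv B (Sum.inr j) (𝓕.series i))

theorem constantCoeff_derivMatrix (𝓕 : FormalGroupLaw g B) (i j : Fin g) :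
    constantCoeff (𝓕.derivMatrix i j) = (1 : Matrix (Fin g) (Fin g) B) i j := by
  have h := congrArg (fun f => constantCoeff (pderiv B j f)) (𝓕.zero_add i)
  simp only [pderiv_subst (hasSubst_of_constantCoeff_zero constantCoeff_elim_zero_X),
    Fintype.sum_sum_type, Sum.elim_inl, Sum.elim_inr, map_zero, mul_zero, Finset.sum_const_zero,
    _root_.zero_add, map_sum, map_mul, constantCoeff_subst_eq constantCoeff_elim_zero_X] at h
  simpa [derivMatrix, constantCoeff_rightZero, pderiv_X, Pi.single_apply, Matrix.one_apply,
    apply_ite constantCoeff] using h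

theorem isUnit_det_derivMatrix (𝓕 : FormalGroupLaw g B) : IsUnit 𝓕.derivMatrix.det := by
  have h : (constantCoeff (R := B)).mapMatrix 𝓕.derivMatrix = 1 := by
    ext i j
    exact 𝓕.constantCoeff_derivMatrix i j
  rw [isUnit_iff_constantCoeff, RingHom.map_det, h, Matrix.det_one]
  exact isUnit_one

theorem rightZero_pderiv_subst_series (𝓕 : FormalGroupLaw g B) {C : Type*} [CommRing C]
    (θ : B →+* C) (f : MvPowerSeries (Fin g) C) (j : Fin g) :
    rightZero (pderiv C (Sum.inr j)
      (subst (fun i => MvPowerSeries.map θ (𝓕.series i)) f)) =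
      ∑ i, pderiv C i f * MvPowerSeries.map θ (𝓕.derivMatrix i j) := by
  have hF : HasSubst fun i => MvPowerSeries.map θ (𝓕.series i) :=
    hasSubst_of_constantCoeff_zero fun i => by
      rw [constantCoeff_map, constantCoeff_series, map_zero]
  have hX : (fun i => rightZero (MvPowerSeries.map θ (𝓕.series i))) = X := by
    ext1 i
    rw [← map_rightZero, rightZero_apply, 𝓕.add_zero, map_X]
  rw [pderiv_subst hF, map_sum]
  refine Finset.sum_congr rfl fun i _ => ?_
  rw [map_mul, rightZero_subst hF, hX, subst_self, id, ← map_pderiv, ← map_rightZero]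
  rfl

theorem rightZero_pderiv_subst_X_inl (f : MvPowerSeries (Fin g) B) (j : Fin g) :
    rightZero (pderiv B (Sum.inr j)
      (subst (fun i => (X (Sum.inl i) : MvPowerSeries (Fin g ⊕ Fin g) B)) f)) = 0 := by
  rw [pderiv_subst (hasSubst_of_constantCoeff_zero fun i => constantCoeff_X _)]
  simp [pderiv_X_of_ne Sum.inl_ne_inr]

theorem rightZero_pderiv_subst_X_inr (f : MvPowerSeries (Fin g) B) (j : Fin g) :
    rightZero (pderiv B (Sum.inr j)
      (subst (fun i => (X (Sum.inr i) : MvPowerSeries (Fin g ⊕ Fin g) B)) f)) =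
      C (coeff (Finsupp.single j 1) f) := by
  have hX : HasSubst fun i => (X (Sum.inr i) : MvPowerSeries (Fin g ⊕ Fin g) B) :=
    hasSubst_of_constantCoeff_zero fun i => constantCoeff_X _
  have hj : ∀ i, pderiv B (Sum.inr j) (X (Sum.inr i) : MvPowerSeries (Fin g ⊕ Fin g) B) =
      if i = j then 1 else 0 := fun i => by
    split_ifs with h
    · rw [h, pderiv_X_self]
    · exact pderiv_X_of_ne (by simpa using h)
  have h0 : (fun i => rightZero (X (Sum.inr i) : MvPowerSeries (Fin g ⊕ Fin g) B)) = 0 :=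
    funext fun i => rightZero_X _
  simp only [pderiv_subst hX, hj, mul_ite, mul_one, mul_zero, Finset.sum_ite_eq',
    Finset.mem_univ, if_true]
  rw [rightZero_subst hX, h0, subst_zero_eq_C_constantCoeff, ← coeff_zero_eq_constantCoeff_apply,
    coeff_pderiv, _root_.zero_add]
  simp

namespace IsLogarithm

variable {𝓕 : FormalGroupLaw g B} {l : Fin g → MvPowerSeries (Fin g) (ℚ ⊗[ℤ] B)}

theorem sum_pderiv_mul_derivMatrix (hl : 𝓕.IsLogarithm l) (k j : Fin g) :
    ∑ i, pderiv _ i (l k) * MvPowerSeries.map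
      (Algebra.TensorProduct.includeRight : B →ₐ[ℤ] ℚ ⊗[ℤ] B).toRingHom (𝓕.derivMatrix i j) =
      (1 : Matrix (Fin g) (Fin g) (MvPowerSeries (Fin g) (ℚ ⊗[ℤ] B))) k j := by
  rw [← rightZero_pderiv_subst_series, hl.map_add, _root_.map_add, _root_.map_add,
    rightZero_pderiv_subst_X_inl, rightZero_pderiv_subst_X_inr, hl.linear_eq, _root_.zero_add,
    Matrix.one_apply]
  simp only [eq_comm, apply_ite C, map_one, map_zero]

theorem exists_pderiv_eq_map (hl : 𝓕.IsLogarithm l) (k i : Fin g) :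
    ∃ f : MvPowerSeries (Fin g) B, pderiv _ i (l k) = MvPowerSeries.map
      (Algebra.TensorProduct.includeRight : B →ₐ[ℤ] ℚ ⊗[ℤ] B).toRingHom f := by
  set θ := MvPowerSeries.map (σ := Fin g)
    (Algebra.TensorProduct.includeRight : B →ₐ[ℤ] ℚ ⊗[ℤ] B).toRingHom
  let D : Matrix (Fin g) (Fin g) (MvPowerSeries (Fin g) (ℚ ⊗[ℤ] B)) :=
    .of fun k i => pderiv _ i (l k)
  have hD : D * θ.mapMatrix 𝓕.derivMatrix = 1 :=
    Matrix.ext fun k j => hl.sum_pderiv_mul_derivMatrix k j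
  have hinv : θ.mapMatrix 𝓕.derivMatrix * θ.mapMatrix 𝓕.derivMatrix⁻¹ = 1 := by
    rw [← map_mul, Matrix.mul_nonsing_inv _ 𝓕.isUnit_det_derivMatrix, map_one]
  have h : D = θ.mapMatrix 𝓕.derivMatrix⁻¹ := left_inv_eq_right_inv hD hinv
  exact ⟨𝓕.derivMatrix⁻¹ k i, congrFun (congrFun h k) i⟩

end IsLogarithm
end FormalGroupLaw
end LogarithmDerivatives

section Arithmetic

open Filter

theorem log_le_log_add_div {p e : ℕ} (hp : 1 < p) (he : 0 < e) (n : ℕ) :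
    Nat.log p n ≤ Nat.log p e + 1 + n / e := by
  rcases eq_or_ne n 0 with rfl | hn
  · simp
  refine (Nat.log_lt_of_lt_pow hn ?_).le
  calc n < e * (n / e + 1) := Nat.lt_mul_div_succ n he
    _ ≤ p ^ (Nat.log p e + 1) * p ^ (n / e) :=
      Nat.mul_le_mul (Nat.lt_pow_succ_log_self hp e).le (Nat.lt_pow_self hp)
    _ = p ^ (Nat.log p e + 1 + n / e) := (pow_add _ _ _).symm

theorem eventually_add_log_le_div {p e : ℕ} (hp : 1 < p) (he : 0 < e) (N : ℕ) :
    ∀ᶠ n in atTop, N + Nat.log p n ≤ n / e := by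
  filter_upwards [eventually_ge_atTop (2 * (N + Nat.log p (e * 2) + 1) * e)] with n hn
  have hlog := log_le_log_add_div hp (Nat.mul_pos he two_pos) n
  have hdiv : 2 * (N + Nat.log p (e * 2) + 1) ≤ n / e := (Nat.le_div_iff_mul_le he).2 hn
  rw [← Nat.div_div_eq_div_mul] at hlog
  omega

theorem tendsto_degree_cofinite {σ : Type*} [Finite σ] :
    Tendsto (Finsupp.degree : (σ →₀ ℕ) → ℕ) cofinite atTop := by
  refine tendsto_atTop.2 fun n => ?_
  simp only [eventually_cofinite, not_le]
  exact Finsupp.finite_of_degree_lt n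

theorem exists_pow_log_mul_eq {O : Type*} [CommRing O] {p e : ℕ} (hp : 1 < p) (he : 0 < e) {ϖ : O}
    (hϖ : (p : O) ∣ ϖ ^ e) (n : ℕ) :
    ∃ d : O, (p : O) ^ (n / e - Nat.log p n) ∣ d ∧
      (p : O) ^ Nat.log p n * d = (p : O) ^ (Nat.log p e + 1) * ϖ ^ n := by
  obtain ⟨w, hw⟩ : (p : O) ^ (n / e) ∣ ϖ ^ n :=
    (pow_dvd_pow_of_dvd hϖ _).trans (pow_mul ϖ e _ ▸ pow_dvd_pow _ (Nat.mul_div_le n e))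
  refine ⟨(p : O) ^ (Nat.log p e + 1 + n / e - Nat.log p n) * w,
    (pow_dvd_pow _ (by omega)).mul_right _, ?_⟩
  rw [← mul_assoc, ← pow_add, Nat.add_sub_cancel' (log_le_log_add_div hp he n), hw, ← mul_assoc,
    ← pow_add]

end Arithmetic

section PadicSum

open Filter

variable {ι C D : Type*} [CommRing C] [CommRing D] {p : ℕ} {t : ι → C} {x y : C}

theorem smodEq_span_pow_iff {a : C} {n : ℕ} :
    x ≡ y [SMOD (Ideal.span {a} ^ n • ⊤ : Ideal C)] ↔ a ^ n ∣ x - y := by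
  rw [SModEq.sub_mem, Ideal.span_singleton_pow, smul_eq_mul, Ideal.mul_top,
    Ideal.mem_span_singleton]

/-- The family `t` sums to `x` for the `p`-adic topology. -/
def HasPadicSum (p : ℕ) (t : ι → C) (x : C) : Prop :=
  ∀ n, ∀ᶠ s in atTop, (p : C) ^ n ∣ x - ∑ i ∈ s, t i

theorem HasPadicSum.map (h : HasPadicSum p t x) (f : C →+* D) :
    HasPadicSum p (fun i => f (t i)) (f x) := fun n => by
  filter_upwards [h n] with s hs
  simpa only [map_pow, map_natCast, map_sub, map_sum] using map_dvd f hs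

theorem HasPadicSum.mul_left (h : HasPadicSum p t x) (c : C) :
    HasPadicSum p (fun i => c * t i) (c * x) := fun n => by
  filter_upwards [h n] with s hs
  rw [← Finset.mul_sum, ← mul_sub]
  exact hs.mul_left c

theorem HasPadicSum.unique [IsHausdorff (Ideal.span {(p : C)}) C] (hx : HasPadicSum p t x)
    (hy : HasPadicSum p t y) : x = y := by
  refine (IsHausdorff.eq_iff_smodEq (I := Ideal.span {(p : C)})).2 fun n => ?_
  obtain ⟨s, hxs, hys⟩ := ((hx n).and (hy n)).exists
  rw [smodEq_span_pow_iff]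
  simpa only [sub_sub_sub_cancel_right] using dvd_sub hxs hys

theorem dvd_sum_sub_sum {d : C} {s u : Finset ι} (hsu : s ⊆ u)
    (ht : ∀ i ∉ s, d ∣ t i) : d ∣ ∑ i ∈ u, t i - ∑ i ∈ s, t i := by
  classical
  rw [← Finset.sum_sdiff hsu, add_sub_cancel_right]
  exact Finset.dvd_sum fun i hi => ht i (Finset.mem_sdiff.1 hi).2

theorem exists_hasPadicSum [IsPrecomplete (Ideal.span {(p : C)}) C]
    (ht : ∀ n, ∀ᶠ i in cofinite, (p : C) ^ n ∣ t i) : ∃ x, HasPadicSum p t x := by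
  let s (n : ℕ) : Finset ι := (eventually_cofinite.1 (ht n)).toFinset
  have hs {n : ℕ} {i : ι} (hi : i ∉ s n) : (p : C) ^ n ∣ t i := by simpa [s] using hi
  have hmono {m n : ℕ} (hmn : m ≤ n) : s m ⊆ s n := fun i hi => by
    by_contra hin
    exact (by simpa [s] using hi : ¬ (p : C) ^ m ∣ t i) ((pow_dvd_pow _ hmn).trans (hs hin))
  obtain ⟨x, hx⟩ := IsPrecomplete.prec (I := Ideal.span {(p : C)}) (M := C) inferInstance
    (f := fun n => ∑ i ∈ s n, t i) fun {m n} hmn =>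
      (smodEq_span_pow_iff.2 (dvd_sum_sub_sum (hmono hmn) fun i hi => hs hi)).symm
  refine ⟨x, fun n => ?_⟩
  filter_upwards [eventually_ge_atTop (s n)] with u hu
  have hxn := smodEq_span_pow_iff.1 (hx n).symm
  simpa only [sub_sub_sub_cancel_right] using
    dvd_sub hxn (dvd_sum_sub_sum hu fun i hi => hs hi)

end PadicSum

section AdicCompleteness

variable {p : ℕ} {A B C P : Type*} [CommRing A] [CommRing B] [CommRing C] [CommRing P]

theorem map_span_natCast (f : A →+* B) :
    (Ideal.span {(p : A)}).map f = Ideal.span {(p : B)} := by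
  rw [Ideal.map_span, Set.image_singleton, map_natCast]

theorem eq_of_forall_pow_dvd_sub [IsHausdorff (Ideal.span {(p : C)}) C] {x y : C}
    (h : ∀ n, (p : C) ^ n ∣ x - y) : x = y :=
  (IsHausdorff.eq_iff_smodEq (I := Ideal.span {(p : C)})).2 fun n => smodEq_span_pow_iff.2 (h n)

theorem surjective_of_forall_dvd_sub [IsPrecomplete (Ideal.span {(p : A)}) A]
    [IsHausdorff (Ideal.span {(p : C)}) C] (f : A →+* C) (hf : ∀ c, ∃ a, (p : C) ∣ c - f a) :
    Function.Surjective f := by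
  have hmap := map_span_natCast (p := p) f
  have : IsHausdorff ((Ideal.span {(p : A)}).map f) C := hmap ▸ ‹_›
  refine surjective_of_mk_map_comp_surjective (I := Ideal.span {(p : A)}) f fun c => ?_
  obtain ⟨c, rfl⟩ := Ideal.Quotient.mk_surjective c
  obtain ⟨a, ha⟩ := hf c
  refine ⟨a, ?_⟩
  rwa [RingHom.comp_apply, eq_comm, Ideal.Quotient.mk_eq_mk_iff_sub_mem, hmap,
    Ideal.mem_span_singleton]

theorem isUnit_natCast_of_not_dvd [IsAdicComplete (Ideal.span {(p : C)}) C] (hp : p.Prime) {u : ℕ}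
    (hu : ¬ p ∣ u) : IsUnit (u : C) := by
  obtain ⟨a, b, hab⟩ := ((Nat.Prime.coprime_iff_not_dvd hp).2 hu).isCoprime
  have hab' : (u : C) * b = p * (-a) + 1 := by
    have := congrArg (Int.cast : ℤ → C) hab
    push_cast at this
    linear_combination this
  have hjac : (p : C) ∈ (⊥ : Ideal C).jacobson :=
    IsAdicComplete.le_jacobson_bot _ (Ideal.mem_span_singleton_self _)
  exact isUnit_of_mul_isUnit_left (hab' ▸ Ideal.mem_jacobson_bot.1 hjac (-(a : C)))

theorem natCast_pow_dvd_iff_repr [Algebra B C] {ι : Type*} [Finite ι] (b : Module.Basis ι B C)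
    {n : ℕ} {x : C} : (p : C) ^ n ∣ x ↔ ∀ i, (p : B) ^ n ∣ b.repr x i := by
  have := Fintype.ofFinite ι
  have hsmul (y : C) : (p : C) ^ n * y = (p : B) ^ n • y := by
    rw [Algebra.smul_def, map_pow, map_natCast]
  constructor
  · rintro ⟨y, rfl⟩ i
    exact ⟨b.repr y i, by rw [hsmul, map_smul, Finsupp.smul_apply, smul_eq_mul]⟩
  · intro h
    choose y hy using h
    refine ⟨∑ i, y i • b i, ?_⟩
    rw [hsmul, Finset.smul_sum, ← b.sum_repr x]
    exact Finset.sum_congr rfl fun i _ => by rw [hy, mul_smul]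

theorem isAdicComplete_of_free_of_finite [Algebra B C] [Module.Free B C] [Module.Finite B C]
    [IsAdicComplete (Ideal.span {(p : B)}) B] : IsAdicComplete (Ideal.span {(p : C)}) C where
  haus' x hx := by
    refine (Module.Free.chooseBasis B C).ext_elem fun i => ?_
    rw [map_zero, Finsupp.zero_apply]
    refine eq_of_forall_pow_dvd_sub (p := p) fun n => ?_
    rw [sub_zero]
    refine (natCast_pow_dvd_iff_repr (Module.Free.chooseBasis B C)).1 ?_ i
    simpa only [sub_zero] using smodEq_span_pow_iff.1 (hx n)
  prec' f hf := by
    let b := Module.Free.chooseBasis B C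
    have hlim (i) : ∃ L : B, ∀ n, (p : B) ^ n ∣ b.repr (f n) i - L := by
      obtain ⟨L, hL⟩ := IsPrecomplete.prec (I := Ideal.span {(p : B)}) (M := B) inferInstance
        (f := fun n => b.repr (f n) i) fun {m n} hmn => smodEq_span_pow_iff.2 <| by
          simpa only [map_sub, Finsupp.sub_apply] using
            (natCast_pow_dvd_iff_repr b).1 (smodEq_span_pow_iff.1 (hf hmn)) i
      exact ⟨L, fun n => smodEq_span_pow_iff.1 (hL n)⟩
    choose L hL using hlim
    refine ⟨b.equivFun.symm L, fun n => smodEq_span_pow_iff.2 ?_⟩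
    refine (natCast_pow_dvd_iff_repr b).2 fun i => ?_
    simpa only [map_sub, Finsupp.sub_apply, b.equivFun_symm_apply, b.repr_sum_self] using hL i n

instance isAdicComplete_tensorProduct {O O' : Type*} [CommRing O] [CommRing O'] [Algebra O O']
    [Module.Free O O'] [Module.Finite O O'] [Algebra O B]
    [IsAdicComplete (Ideal.span {(p : B)}) B] :
    IsAdicComplete (Ideal.span {(p : O' ⊗[O] B)}) (O' ⊗[O] B) := by
  let e : B ⊗[O] O' ≃+* O' ⊗[O] B := (Algebra.TensorProduct.comm O B O').toRingEquiv
  have : IsAdicComplete (Ideal.span {(p : B ⊗[O] O')}) (B ⊗[O] O') :=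
    isAdicComplete_of_free_of_finite (B := B)
  have hcomplete := (IsAdicComplete.congr_ringEquiv (Ideal.span {(p : B ⊗[O] O')}) e).2 this
  rwa [show Ideal.map e (Ideal.span {(p : B ⊗[O] O')}) = _ from
    map_span_natCast (e : B ⊗[O] O' →+* O' ⊗[O] B)] at hcomplete

theorem span_natCast_fg : (Ideal.span {(p : P)}).FG := ⟨{(p : P)}, by simp⟩

instance isAdicComplete_adicCompletion :
    IsAdicComplete (Ideal.span {(p : AdicCompletion (Ideal.span {(p : P)}) P)})
      (AdicCompletion (Ideal.span {(p : P)}) P) := by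
  have hcomplete := AdicCompletion.isAdicComplete (M := P) (span_natCast_fg (p := p) (P := P))
  rwa [← IsAdicComplete.map_algebraMap_iff
    (S := AdicCompletion (Ideal.span {(p : P)}) P), map_span_natCast] at hcomplete

theorem evalₐ_algebraMap (n : ℕ) (q : P) :
    AdicCompletion.evalₐ (Ideal.span {(p : P)}) n (algebraMap P _ q) = Ideal.Quotient.mk _ q :=
  AdicCompletion.evalₐ_of _ n q

theorem evalₐ_eq_zero_iff {n : ℕ} {x : AdicCompletion (Ideal.span {(p : P)}) P} :
    AdicCompletion.evalₐ _ n x = 0 ↔ (p : AdicCompletion (Ideal.span {(p : P)}) P) ^ n ∣ x := by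
  have heval : AdicCompletion.evalₐ (Ideal.span {(p : P)}) n x = 0 ↔
      AdicCompletion.eval (Ideal.span {(p : P)}) P n x = 0 :=
    ⟨fun h => by
      rw [← AdicCompletion.factor_evalₐ_eq_eval _ x (Ideal.mul_top _).ge, h, map_zero],
    fun h => by
      rw [← AdicCompletion.factor_eval_eq_evalₐ _ x (Ideal.mul_top _).le, h, map_zero]⟩
  rw [heval, ← LinearMap.mem_ker, ← AdicCompletion.pow_smul_top_eq_ker_eval span_natCast_fg]
  rw [Ideal.smul_top_eq_map, Submodule.restrictScalars_mem, Ideal.map_pow, map_span_natCast,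
    Ideal.span_singleton_pow, Ideal.mem_span_singleton]

theorem evalₐ_eq_mk_iff {n : ℕ} {x : AdicCompletion (Ideal.span {(p : P)}) P} {q : P} :
    AdicCompletion.evalₐ _ n x = Ideal.Quotient.mk _ q ↔
      (p : AdicCompletion (Ideal.span {(p : P)}) P) ^ n ∣ x - algebraMap P _ q := by
  rw [← evalₐ_eq_zero_iff, map_sub, evalₐ_algebraMap, sub_eq_zero]

theorem exists_pow_dvd_sub_algebraMap (n : ℕ) (x : AdicCompletion (Ideal.span {(p : P)}) P) :
    ∃ q : P, (p : AdicCompletion (Ideal.span {(p : P)}) P) ^ n ∣ x - algebraMap P _ q := by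
  obtain ⟨q, hq⟩ := Ideal.Quotient.mk_surjective (AdicCompletion.evalₐ _ n x)
  exact ⟨q, evalₐ_eq_mk_iff.1 hq.symm⟩

theorem ringHom_adicCompletion_ext [IsHausdorff (Ideal.span {(p : C)}) C]
    {f f' : AdicCompletion (Ideal.span {(p : P)}) P →+* C}
    (h : f.comp (algebraMap P _) = f'.comp (algebraMap P _)) : f = f' := by
  ext x
  refine eq_of_forall_pow_dvd_sub (p := p) fun n => ?_
  obtain ⟨q, hq⟩ := exists_pow_dvd_sub_algebraMap n x
  have hf := map_dvd f hq
  have hf' := map_dvd f' hq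
  rw [map_pow, map_natCast, map_sub] at hf hf'
  have hq : f (algebraMap P _ q) = f' (algebraMap P _ q) := congrArg (fun h => h q) h
  simpa only [hq, sub_sub_sub_cancel_right] using dvd_sub hf hf'

theorem exists_ringHom_adicCompletion [IsAdicComplete (Ideal.span {(p : C)}) C] (f : P →+* C) :
    ∃ f' : AdicCompletion (Ideal.span {(p : P)}) P →+* C, f'.comp (algebraMap P _) = f := by
  have hle (n : ℕ) : Ideal.span {(p : P)} ^ n ≤ (Ideal.span {(p : C)} ^ n).comap f := by
    rw [← Ideal.map_le_iff_le_comap, Ideal.map_pow, map_span_natCast]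
  let F (n : ℕ) : AdicCompletion (Ideal.span {(p : P)}) P →+* C ⧸ Ideal.span {(p : C)} ^ n :=
    (Ideal.quotientMap _ f (hle n)).comp
      (AdicCompletion.evalₐ (Ideal.span {(p : P)}) n : _ →+* _)
  have hF {m n : ℕ} (hmn : m ≤ n) : (Ideal.Quotient.factorPow _ hmn).comp (F n) = F m := by
    ext x
    obtain ⟨q, hq⟩ := exists_pow_dvd_sub_algebraMap n x
    simp only [F, RingHom.comp_apply, RingHom.coe_coe, evalₐ_eq_mk_iff.2 hq,
      evalₐ_eq_mk_iff.2 ((pow_dvd_pow _ hmn).trans hq), Ideal.quotientMap_mk]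
    rfl
  refine ⟨IsAdicComplete.liftRingHom _ F hF, RingHom.ext fun q => ?_⟩
  refine eq_of_forall_pow_dvd_sub (p := p) fun n => ?_
  rw [← Ideal.mem_span_singleton, ← Ideal.span_singleton_pow,
    ← Ideal.Quotient.mk_eq_mk_iff_sub_mem, RingHom.comp_apply, IsAdicComplete.mk_liftRingHom]
  simp only [F, RingHom.comp_apply, RingHom.coe_coe, evalₐ_algebraMap, Ideal.quotientMap_mk]

end AdicCompleteness

section PhiPoly

open MvPolynomial

variable {p g : ℕ}

theorem phiPoly_C {O : Type*} [CommRing O] (θ : O →+* O) (a : O) :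
    phiPoly p g θ (C a) = C (θ a) := by
  rw [phiPoly, coe_eval₂Hom, eval₂_C, RingHom.comp_apply]

theorem phiPoly_X {O : Type*} [CommRing O] (θ : O →+* O) (jk : ℕ × Fin g) :
    phiPoly p g θ (X jk) = X jk ^ p + (p : MvPolynomial (ℕ × Fin g) O) * X (jk.1 + 1, jk.2) := by
  rw [phiPoly, coe_eval₂Hom, eval₂_X]

theorem map_iterate_phiPoly {O : Type*} [CommRing O] (θ : O →+* O) (r : ℕ)
    (z : MvPolynomial (ℕ × Fin g) ℤ) :
    map (Int.castRingHom O) ((phiPoly p g (RingHom.id ℤ))^[r] z) =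
      (phiPoly p g θ)^[r] (map (Int.castRingHom O) z) := by
  have hcomp : (map (Int.castRingHom O)).comp (phiPoly p g (RingHom.id ℤ)) =
      (phiPoly p g θ).comp (map (Int.castRingHom O)) :=
    ringHom_ext (by simp) fun jk => by simp [phiPoly_X]
  exact Function.Semiconj.iterate_right (fun z => congrArg (fun f => f z) hcomp) r z

theorem constantCoeff_iterate_phiPoly (hp : p ≠ 0) (r : ℕ) (z : MvPolynomial (ℕ × Fin g) ℤ) :
    constantCoeff ((phiPoly p g (RingHom.id ℤ))^[r] z) = constantCoeff z := by
  have hcomp : constantCoeff.comp (phiPoly p g (RingHom.id ℤ)) = constantCoeff :=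
    ringHom_ext (by simp) fun jk => by simp [phiPoly_X, hp]
  induction r with
  | zero => rfl
  | succ r ih => rw [Function.iterate_succ_apply', ← RingHom.comp_apply, hcomp, ih]

variable [Fact p.Prime] {O : Type*} [CommRing O] (F : FrobeniusBase p O)

theorem phiPoly_deltaPoly (j : ℕ) (k : Fin g) :
    phiPoly p g F.φ (deltaPoly g F j k) =
      deltaPoly g F j k ^ p + C F.ϖ * deltaPoly g F (j + 1) k :=
  eq_add_of_sub_eq' (phiPoly_dvd g F (deltaPoly g F j k)).choose_spec

variable (g) in
/-- The `O`-algebra generated by the polynomials expressing `δ_π^j T_k` for `j ≤ m`. -/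
noncomputable def deltaSubalgebra (m : ℕ) : Subalgebra O (MvPolynomial (ℕ × Fin g) O) :=
  Algebra.adjoin O {z | ∃ j ≤ m, ∃ k, z = deltaPoly g F j k}

theorem deltaPoly_mem_deltaSubalgebra {j m : ℕ} (h : j ≤ m) (k : Fin g) :
    deltaPoly g F j k ∈ deltaSubalgebra g F m :=
  Algebra.subset_adjoin ⟨j, h, k, rfl⟩

theorem C_mem_deltaSubalgebra (m : ℕ) (a : O) : C a ∈ deltaSubalgebra g F m :=
  Subalgebra.algebraMap_mem _ a

theorem phiPoly_mem_deltaSubalgebra {m : ℕ} {z : MvPolynomial (ℕ × Fin g) O}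
    (hz : z ∈ deltaSubalgebra g F m) : phiPoly p g F.φ z ∈ deltaSubalgebra g F (m + 1) := by
  induction hz using Algebra.adjoin_induction with
  | mem z hz =>
    obtain ⟨j, hj, k, rfl⟩ := hz
    rw [phiPoly_deltaPoly]
    exact add_mem (pow_mem (deltaPoly_mem_deltaSubalgebra F (by lia) k) _)
      (mul_mem (C_mem_deltaSubalgebra F _ _) (deltaPoly_mem_deltaSubalgebra F (by lia) k))
  | algebraMap a =>
    rw [algebraMap_eq, phiPoly_C]
    exact C_mem_deltaSubalgebra F _ _
  | add x y _ _ hx hy => rw [map_add]; exact add_mem hx hy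
  | mul x y _ _ hx hy => rw [map_mul]; exact mul_mem hx hy

theorem exists_iterate_phiPoly_eq (r : ℕ) (i : Fin g) :
    ∃ q ∈ deltaSubalgebra g F r,
      (phiPoly p g F.φ)^[r] (X (0, i)) = X (0, i) ^ p ^ r + C F.ϖ * q := by
  induction r with
  | zero => exact ⟨0, zero_mem _, by simp⟩
  | succ r ih =>
    obtain ⟨q, hqm, hq⟩ := ih
    let D := deltaSubalgebra g F (r + 1)
    let T : D := ⟨X (0, i), deltaPoly_mem_deltaSubalgebra F (Nat.zero_le _) i⟩
    let T' : D := ⟨deltaPoly g F 1 i, deltaPoly_mem_deltaSubalgebra F (by lia) i⟩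
    let c : D := ⟨C F.ϖ, C_mem_deltaSubalgebra F _ _⟩
    let φq : D := ⟨phiPoly p g F.φ q, phiPoly_mem_deltaSubalgebra F hqm⟩
    let u : D := ⟨C (F.ϖ ^ (p - 1) + F.δ F.ϖ), C_mem_deltaSubalgebra F _ _⟩
    obtain ⟨w, hw⟩ := sub_dvd_pow_sub_pow (T ^ p + c * T') (T ^ p) (p ^ r)
    have hT : phiPoly p g F.φ (X (0, i)) = ((T ^ p + c * T' : D) : MvPolynomial _ O) :=
      phiPoly_deltaPoly F 0 i
    have hϖ : F.φ F.ϖ = F.ϖ * (F.ϖ ^ (p - 1) + F.δ F.ϖ) := by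
      rw [F.φ_eq, mul_add, mul_pow_sub_one (Fact.out : p.Prime).ne_zero]
    have hD : (T ^ p + c * T') ^ p ^ r + c * u * φq = T ^ p ^ (r + 1) + c * (T' * w + u * φq) := by
      rw [pow_succ' p r, pow_mul]
      linear_combination hw
    refine ⟨(T' * w + u * φq : D), Subtype.property _, ?_⟩
    rw [Function.iterate_succ_apply', hq, map_add, map_pow, map_mul, phiPoly_C, hT, hϖ, map_mul]
    exact congrArg Subtype.val hD

end PhiPoly

section JetPolynomials

open MvPolynomial

variable {p g : ℕ} (r : ℕ) (B : Type*) [CommRing B]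

theorem map_aeval_atZero {B' : Type*} [CommRing B'] (θ : B →+* B')
    (z : MvPolynomial (ℕ × Fin g) ℤ) :
    map θ (aeval (atZero r g B) z) = aeval (atZero r g B') z := by
  have hcomp : (map θ).comp (aeval (atZero r g B) : _ →ₐ[ℤ] _).toRingHom =
      (aeval (atZero r g B') : _ →ₐ[ℤ] _).toRingHom :=
    ringHom_ext (by simp) fun jk => by
      simp only [RingHom.comp_apply, AlgHom.toRingHom_eq_coe, RingHom.coe_coe, aeval_X, atZero]
      split_ifs <;> simp
  exact congrArg (fun f => f z) hcomp

theorem constantCoeff_aeval_atZero (z : MvPolynomial (ℕ × Fin g) ℤ) :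
    constantCoeff (aeval (atZero r g B) z) = ((constantCoeff z : ℤ) : B) := by
  have hcomp : constantCoeff.comp (aeval (atZero r g B) : _ →ₐ[ℤ] _).toRingHom =
      (Int.castRingHom B).comp constantCoeff :=
    ringHom_ext (by simp) fun jk => by
      simp only [RingHom.comp_apply, AlgHom.toRingHom_eq_coe, RingHom.coe_coe, aeval_X, atZero]
      split_ifs <;> simp
  exact congrArg (fun f => f z) hcomp

variable (p) in
/-- The polynomial `φ^r(T_i)|_{T = 0}`, which `jetLog` substitutes for `T_i`. -/
noncomputable def phiAtZero (i : Fin g) : MvPolynomial (Fin r × Fin g) B :=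
  aeval (atZero r g B) ((phiPoly p g (RingHom.id ℤ))^[r] (X (0, i)))

theorem map_phiAtZero {B' : Type*} [CommRing B'] (θ : B →+* B') (i : Fin g) :
    map θ (phiAtZero p r B i) = phiAtZero p r B' i :=
  map_aeval_atZero r B θ _

theorem constantCoeff_phiAtZero (hp : p ≠ 0) (i : Fin g) :
    constantCoeff (phiAtZero p r B i) = 0 := by
  rw [phiAtZero, constantCoeff_aeval_atZero, constantCoeff_iterate_phiPoly hp, constantCoeff_X,
    Int.cast_zero]

variable [Fact p.Prime]

variable (p) in
/-- The ring `ℤ` with `ϖ = p` and the identity as lift of the Frobenius of `ℤ / p`. -/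
def baseInt : FrobeniusBase p ℤ where
  ϖ := p
  quo := 1
  φ := RingHom.id ℤ
  δ x := (x - x ^ p) / p
  ϖ_mul_quo := mul_one _
  φ_eq x := by
    have hdvd : (p : ℤ) ∣ x - x ^ p := by
      rw [← ZMod.intCast_zmod_eq_zero_iff_dvd]
      simp
    rw [Int.mul_ediv_cancel' hdvd, RingHom.id_apply, add_sub_cancel]

theorem exists_phiAtZero_eq (i : Fin g) :
    ∃ P, phiAtZero p r B i = (p : MvPolynomial (Fin r × Fin g) B) * P := by
  obtain ⟨q, -, hq⟩ := exists_iterate_phiPoly_eq (baseInt p) r i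
  have hzero : atZero r g B (0, i) = 0 := dif_neg (by simp)
  refine ⟨aeval (atZero r g B) q, ?_⟩
  rw [phiAtZero, show RingHom.id ℤ = (baseInt p).φ from rfl, hq, map_add, map_pow, aeval_X, hzero,
    zero_pow (pow_ne_zero _ (Fact.out : p.Prime).ne_zero), zero_add, map_mul]
  simp [baseInt]

variable (p) in
/-- The polynomial `φ^r(T_i)|_{T = 0} / p`; over a ring with `p`-torsion it depends on a choice. -/
noncomputable def jetPoly (i : Fin g) : MvPolynomial (Fin r × Fin g) B :=
  (exists_phiAtZero_eq (p := p) r B i).choose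

theorem phiAtZero_eq (i : Fin g) :
    phiAtZero p r B i = (p : MvPolynomial (Fin r × Fin g) B) * jetPoly p r B i :=
  (exists_phiAtZero_eq r B i).choose_spec

end JetPolynomials

section Numerators

variable {p g : ℕ} {B : Type*} [CommRing B] {f : MvPowerSeries (Fin g) (ℚ ⊗[ℤ] B)}
  {b : (Fin g →₀ ℕ) → B}

/-- `f` has zero constant term and `b α` is a numerator of its coefficient at `T ^ α` over the
denominator `p ^ ⌊log_p |α|⌋`. -/
structure IsNumerator (p : ℕ) (f : MvPowerSeries (Fin g) (ℚ ⊗[ℤ] B)) (b : (Fin g →₀ ℕ) → B) :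
    Prop where
  zero : b 0 = 0
  pow_log_mul_coeff (α : Fin g →₀ ℕ) :
    (p : ℚ ⊗[ℤ] B) ^ Nat.log p α.degree * MvPowerSeries.coeff α f = 1 ⊗ₜ b α

theorem IsNumerator.map (h : IsNumerator p f b) {B' : Type*} [CommRing B'] (ψ : B →+* B') :
    IsNumerator p (MvPowerSeries.map
      (Algebra.TensorProduct.map (AlgHom.id ℤ ℚ) ψ.toIntAlgHom).toRingHom f) (ψ ∘ b) where
  zero := by rw [Function.comp_apply, h.zero, map_zero]
  pow_log_mul_coeff α := by
    have hα := congrArg (Algebra.TensorProduct.map (AlgHom.id ℤ ℚ) ψ.toIntAlgHom).toRingHom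
      (h.pow_log_mul_coeff α)
    rw [map_mul, map_pow, map_natCast] at hα
    exact hα

-- If `α_j = p^m u` with `p ∤ u`, then `u` is a unit and the coefficient of `∂_j l` is integral.
theorem FormalGroupLaw.IsLogarithm.exists_pow_log_mul_coeff
    [IsAdicComplete (Ideal.span {(p : B)}) B] (hp : p.Prime) {𝓕 : FormalGroupLaw g B}
    {l : Fin g → MvPowerSeries (Fin g) (ℚ ⊗[ℤ] B)} (hl : 𝓕.IsLogarithm l) (k : Fin g)
    {α : Fin g →₀ ℕ} (hα : α ≠ 0) :
    ∃ c : B, (p : ℚ ⊗[ℤ] B) ^ Nat.log p α.degree * MvPowerSeries.coeff α (l k) = 1 ⊗ₜ c := by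
  obtain ⟨j, hj⟩ := Finsupp.ne_iff.1 hα
  obtain ⟨n, rfl⟩ : ∃ n, α = n + Finsupp.single j 1 :=
    ⟨α - Finsupp.single j 1, (tsub_add_cancel_of_le
      (Finsupp.single_le_iff.2 (Nat.one_le_iff_ne_zero.2 hj))).symm⟩
  set α := n + Finsupp.single j 1 with hα_def
  obtain ⟨m, u, hu, hmu⟩ := Nat.exists_eq_pow_mul_and_not_dvd hj p hp.ne_one
  have hm : m ≤ Nat.log p α.degree :=
    Nat.le_log_of_pow_le hp.one_lt <| (Nat.le_of_dvd (Nat.pos_of_ne_zero hj)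
      (hmu ▸ dvd_mul_right _ _)).trans (Finsupp.le_degree j α)
  obtain ⟨d, hd⟩ := Nat.exists_eq_add_of_le hm
  obtain ⟨w, hw⟩ := (isUnit_natCast_of_not_dvd (C := B) hp hu).exists_right_inv
  obtain ⟨f, hf⟩ := hl.exists_pderiv_eq_map k j
  let θ : B →ₐ[ℤ] ℚ ⊗[ℤ] B := Algebra.TensorProduct.includeRight
  have hcoeff : MvPowerSeries.coeff α (l k) * ((p : ℚ ⊗[ℤ] B) ^ m * u) =
      θ (MvPowerSeries.coeff n f) := by
    have hαj : ((n j : ℚ ⊗[ℤ] B) + 1) = (p : ℚ ⊗[ℤ] B) ^ m * u := by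
      rw [← Nat.cast_pow, ← Nat.cast_mul, ← hmu]
      simp [hα_def]
    rw [← hαj, ← MvPowerSeries.coeff_pderiv, hf, MvPowerSeries.coeff_map]
    rfl
  have hw' : (u : ℚ ⊗[ℤ] B) * θ w = 1 := by
    rw [← map_natCast θ, ← map_mul, hw, map_one]
  refine ⟨p ^ d * w * MvPowerSeries.coeff n f, ?_⟩
  change _ = θ _
  rw [map_mul, map_mul, map_pow, map_natCast, ← hcoeff, hd, pow_add]
  linear_combination (-(p : ℚ ⊗[ℤ] B) ^ m * p ^ d * MvPowerSeries.coeff α (l k)) * hw'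

theorem FormalGroupLaw.IsLogarithm.exists_isNumerator [IsAdicComplete (Ideal.span {(p : B)}) B]
    (hp : p.Prime) {𝓕 : FormalGroupLaw g B} {l : Fin g → MvPowerSeries (Fin g) (ℚ ⊗[ℤ] B)}
    (hl : 𝓕.IsLogarithm l) (k : Fin g) : ∃ b, IsNumerator p (l k) b := by
  have hcoeff (α : Fin g →₀ ℕ) : ∃ c : B, (α = 0 → c = 0) ∧
      (p : ℚ ⊗[ℤ] B) ^ Nat.log p α.degree * MvPowerSeries.coeff α (l k) = 1 ⊗ₜ c := by
    rcases eq_or_ne α 0 with rfl | hα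
    · refine ⟨0, fun _ => rfl, ?_⟩
      rw [MvPowerSeries.coeff_zero_eq_constantCoeff_apply, hl.constantCoeff_eq, mul_zero,
        TensorProduct.tmul_zero]
    · obtain ⟨c, hc⟩ := hl.exists_pow_log_mul_coeff hp k hα
      exact ⟨c, fun h => absurd h hα, hc⟩
  choose b hb using hcoeff
  exact ⟨b, (hb 0).1 rfl, fun α => (hb α).2⟩

end Numerators

section JetTerms

open Filter MvPolynomial

variable {p g : ℕ} (r : ℕ) {B : Type*} [CommRing B]

theorem finsupp_prod_mul_pow {ι : Type*} (α : ι →₀ ℕ) (c : B) (q : ι → B) :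
    (α.prod fun i n => (c * q i) ^ n) = c ^ α.degree * α.prod fun i n => q i ^ n := by
  simp only [mul_pow, Finsupp.prod_mul]
  rw [Finsupp.prod, Finset.prod_pow_eq_pow_sum, Finsupp.degree_apply]

theorem coeff_prod_phiAtZero (α : Fin g →₀ ℕ) (β : Fin r × Fin g →₀ ℕ) :
    MvPowerSeries.coeff β (α.prod fun i n =>
      (phiAtZero p r (ℚ ⊗[ℤ] B) i : MvPowerSeries (Fin r × Fin g) (ℚ ⊗[ℤ] B)) ^ n) =
      1 ⊗ₜ coeff β (α.prod fun i n => phiAtZero p r B i ^ n) := by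
  let θ : B →ₐ[ℤ] ℚ ⊗[ℤ] B := Algebra.TensorProduct.includeRight
  have hθ (i : Fin g) : (phiAtZero p r (ℚ ⊗[ℤ] B) i : MvPowerSeries (Fin r × Fin g) (ℚ ⊗[ℤ] B)) =
      coeToMvPowerSeries.ringHom.comp (MvPolynomial.map θ.toRingHom) (phiAtZero p r B i) := by
    rw [RingHom.comp_apply, map_phiAtZero]
    rfl
  simp only [hθ, ← map_pow]
  rw [← map_finsuppProd, RingHom.comp_apply]
  exact coeff_map θ.toRingHom _ β

theorem hasExpansion_of_hasPadicSum {ι : Type*} {x : JetRing p r g B}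
    {f : MvPowerSeries (Fin r × Fin g) (ℚ ⊗[ℤ] B)} {t : ι → MvPolynomial (Fin r × Fin g) B}
    (ht : ∀ n, ∀ᶠ i in cofinite, (p : MvPolynomial (Fin r × Fin g) B) ^ n ∣ t i)
    (hx : HasPadicSum p (fun i => toJetRing p r g B (t i)) x)
    (hf : ∀ β, (fun i => (1 : ℚ) ⊗ₜ[ℤ] coeff β (t i)).HasFiniteSupport ∧
      MvPowerSeries.coeff β f = ∑ᶠ i, (1 : ℚ) ⊗ₜ[ℤ] coeff β (t i)) :
    HasExpansion x f := by
  classical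
  intro n
  obtain ⟨s, hxs, hs⟩ := ((hx n).and
    (eventually_ge_atTop (eventually_cofinite.1 (ht n)).toFinset)).exists
  have hdvd : ∀ i ∉ s, (p : MvPolynomial (Fin r × Fin g) B) ^ n ∣ t i := fun i hi => by
    by_contra h
    exact hi (hs ((Set.Finite.mem_toFinset _).2 h))
  refine ⟨∑ i ∈ s, t i, evalₐ_eq_mk_iff.2 ?_, fun β => ?_⟩
  · rw [map_sum]
    exact hxs
  · obtain ⟨hfin, hfβ⟩ := hf β
    obtain ⟨z, hz⟩ := dvd_sum_sub_sum (Finset.subset_union_left (s₂ := hfin.toFinset)) hdvd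
    refine ⟨coeff β z, ?_⟩
    rw [hfβ, finsum_eq_sum_of_support_subset (s := s ∪ hfin.toFinset) _
        (fun i hi => Finset.mem_union_right _ (hfin.mem_toFinset.2 hi)),
      ← TensorProduct.tmul_sum, ← coeff_sum, sub_eq_iff_eq_add'.1 hz, coeff_add,
      ← coeff_C_mul, map_pow, map_natCast]

variable [Fact p.Prime]

variable (p) in
/-- The term of `L^r` coming from a term `(c / p ^ ⌊log_p |α|⌋) T ^ α` of the logarithm, where
`b = φ^r(c)`. The subtraction is truncated at `α = 0` only, where `b = 0`. -/
noncomputable def jetTerm (b : B) (α : Fin g →₀ ℕ) : MvPolynomial (Fin r × Fin g) B :=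
  C ((p : B) ^ (α.degree - 1 - Nat.log p α.degree) * b) * α.prod fun i n => jetPoly p r B i ^ n

theorem pow_log_succ_mul_jetTerm {b : B} {α : Fin g →₀ ℕ} (hb : α = 0 → b = 0) :
    (p : MvPolynomial (Fin r × Fin g) B) ^ (Nat.log p α.degree + 1) * jetTerm p r b α =
      C b * α.prod fun i n => phiAtZero p r B i ^ n := by
  simp only [phiAtZero_eq]
  rw [finsupp_prod_mul_pow, jetTerm]
  rcases eq_or_ne α 0 with rfl | hα
  · simp [hb rfl]
  · have hlog := Nat.log_lt_self p ((Finsupp.degree_eq_zero_iff α).not.2 hα)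
    have hdegree : Nat.log p α.degree + 1 + (α.degree - 1 - Nat.log p α.degree) = α.degree := by
      omega
    rw [map_mul, map_pow, map_natCast, mul_assoc, ← mul_assoc (_ ^ _), ← pow_add, hdegree]
    ring

theorem eventually_pow_dvd_jetTerm (b : (Fin g →₀ ℕ) → B) (n : ℕ) :
    ∀ᶠ α in cofinite, (p : MvPolynomial (Fin r × Fin g) B) ^ n ∣ jetTerm p r (b α) α := by
  filter_upwards [tendsto_degree_cofinite.eventually (eventually_add_log_le_div
    (Fact.out : p.Prime).one_lt one_pos (n + 1))] with α hα
  rw [jetTerm, map_mul, map_pow, map_natCast]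
  exact (dvd_mul_of_dvd_left (pow_dvd_pow _ (by rw [Nat.div_one] at hα; omega)) _).mul_right _

theorem inv_smul_coeff_mul_coeff_prod {f : MvPowerSeries (Fin g) (ℚ ⊗[ℤ] B)}
    {b : (Fin g →₀ ℕ) → B} (hb : IsNumerator p f b) (α : Fin g →₀ ℕ) (β : Fin r × Fin g →₀ ℕ) :
    (p : ℚ)⁻¹ • (MvPowerSeries.coeff α f * MvPowerSeries.coeff β (α.prod fun i n =>
      (phiAtZero p r (ℚ ⊗[ℤ] B) i : MvPowerSeries (Fin r × Fin g) (ℚ ⊗[ℤ] B)) ^ n)) =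
      1 ⊗ₜ coeff β (jetTerm p r (b α) α) := by
  let θ : B →ₐ[ℤ] ℚ ⊗[ℤ] B := Algebra.TensorProduct.includeRight
  have hp0 : (p : ℚ) ≠ 0 := Nat.cast_ne_zero.2 (Fact.out : p.Prime).ne_zero
  have hsmul (n : ℕ) (x : ℚ ⊗[ℤ] B) : (p : ℚ) ^ n • x = (p : ℚ ⊗[ℤ] B) ^ n * x := by
    rw [← Nat.cast_pow, Nat.cast_smul_eq_nsmul, nsmul_eq_mul, Nat.cast_pow]
  have hC (n : ℕ) (z : MvPolynomial (Fin r × Fin g) B) :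
      (p : B) ^ n * coeff β z = coeff β ((p : MvPolynomial (Fin r × Fin g) B) ^ n * z) := by
    rw [← coeff_C_mul, map_pow, map_natCast]
  have hcoeff : (p : ℚ ⊗[ℤ] B) ^ Nat.log p α.degree * MvPowerSeries.coeff α f = θ (b α) :=
    hb.pow_log_mul_coeff α
  refine smul_right_injective _ (pow_ne_zero (Nat.log p α.degree + 1) hp0) ?_
  change (p : ℚ) ^ (Nat.log p α.degree + 1) • _ = (p : ℚ) ^ (Nat.log p α.degree + 1) • θ _
  calc (p : ℚ) ^ (Nat.log p α.degree + 1) • (p : ℚ)⁻¹ • _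
      = (p : ℚ ⊗[ℤ] B) ^ Nat.log p α.degree * _ := by
        rw [smul_smul, pow_succ, mul_inv_cancel_right₀ hp0, hsmul]
    _ = θ (b α) * θ (coeff β (α.prod fun i n => phiAtZero p r B i ^ n)) := by
        rw [← mul_assoc, hcoeff, coeff_prod_phiAtZero]
        rfl
    _ = θ ((p : B) ^ (Nat.log p α.degree + 1) * coeff β (jetTerm p r (b α) α)) := by
        rw [← map_mul, hC, pow_log_succ_mul_jetTerm r fun hα => by rw [hα, hb.zero], coeff_C_mul]
    _ = (p : ℚ) ^ (Nat.log p α.degree + 1) • θ (coeff β (jetTerm p r (b α) α)) := by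
        rw [hsmul, map_mul, map_pow, map_natCast]

theorem hasSubst_phiAtZero : MvPowerSeries.HasSubst fun i : Fin g =>
    (phiAtZero p r (ℚ ⊗[ℤ] B) i : MvPowerSeries (Fin r × Fin g) (ℚ ⊗[ℤ] B)) :=
  MvPowerSeries.hasSubst_of_constantCoeff_zero
    (constantCoeff_phiAtZero r (ℚ ⊗[ℤ] B) (Fact.out : p.Prime).ne_zero)

theorem coeff_inv_smul_subst {f : MvPowerSeries (Fin g) (ℚ ⊗[ℤ] B)} {b : (Fin g →₀ ℕ) → B}
    (hb : IsNumerator p f b) (β : Fin r × Fin g →₀ ℕ) :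
    (fun α => (1 : ℚ) ⊗ₜ[ℤ] coeff β (jetTerm p r (b α) α)).HasFiniteSupport ∧
      MvPowerSeries.coeff β ((p : ℚ)⁻¹ • MvPowerSeries.subst (fun i : Fin g =>
        (phiAtZero p r (ℚ ⊗[ℤ] B) i : MvPowerSeries (Fin r × Fin g) (ℚ ⊗[ℤ] B))) f) =
        ∑ᶠ α, (1 : ℚ) ⊗ₜ[ℤ] coeff β (jetTerm p r (b α) α) := by
  have hs := hasSubst_phiAtZero (p := p) (g := g) r (B := B)
  have hfin := (MvPowerSeries.coeff_subst_finite hs f β).smul_right fun _ => (p : ℚ)⁻¹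
  simp only [← inv_smul_coeff_mul_coeff_prod r hb]
  refine ⟨hfin, ?_⟩
  rw [← smul_finsum]
  exact congrArg ((p : ℚ)⁻¹ • ·) (MvPowerSeries.coeff_subst hs f β)

end JetTerms

section BaseChange

theorem isNoetherianRing_tensorProduct {O O' B : Type*} [CommRing O] [CommRing O'] [Algebra O O']
    [Module.Finite O O'] [CommRing B] [Algebra O B] [IsNoetherianRing B] :
    IsNoetherianRing (O' ⊗[O] B) := by
  have : IsNoetherianRing (B ⊗[O] O') := IsNoetherianRing.of_finite B _
  exact isNoetherianRing_of_ringEquiv _ (Algebra.TensorProduct.comm O B O').toRingEquiv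

theorem ProlSeq.InProl.baseChange {p : ℕ} [Fact p.Prime] {O O' : Type} [CommRing O] [CommRing O']
    [Algebra O O'] [Module.Free O O'] [Module.Finite O O'] {F : FrobeniusBase p O}
    {F' : FrobeniusBase p O'} {S : ProlSeq.{u} F} (hS : S.InProl) (h : F.Extends F') :
    (S.baseChange h hS.flat).InProl where
  noetherian r := by
    have := hS.noetherian r
    exact isNoetherianRing_tensorProduct (O := O) (O' := O') (B := S.obj r)
  complete r := by
    have := hS.complete r
    exact isAdicComplete_tensorProduct (O := O) (O' := O') (B := S.obj r)
  flat r := by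
    have := hS.flat r
    exact inferInstanceAs (Module.Flat O' (O' ⊗[O] S.obj r))

instance flat_jetRing {p r g : ℕ} {O B : Type*} [CommRing O] [CommRing B] [Algebra O B]
    [Module.Flat O B] [IsNoetherianRing B] : Module.Flat O (JetRing p r g B) := by
  have : Module.Flat O (MvPolynomial (Fin r × Fin g) B) := Module.Flat.trans O B _
  exact Module.Flat.trans O (MvPolynomial (Fin r × Fin g) B) _

theorem isLeftRegular_natCast_of_flat {p : ℕ} {O C : Type*} [CommRing O] [CommRing C] [Algebra O C]
    [Module.Flat O C] (hp : (p : O) ∈ nonZeroDivisors O) : IsLeftRegular (p : C) := fun x y hxy =>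
  Module.Flat.isSMulRegular_of_nonZeroDivisors (M := C) hp <| by
    simpa only [Algebra.smul_def, map_natCast] using hxy

end BaseChange

section EvalAtZero

open MvPolynomial

variable (p r g : ℕ) (O O' B : Type*) [CommRing O] [CommRing O'] [Algebra O O'] [CommRing B]
  [Algebra O B]

/-- Evaluation at `T = 0` of polynomials in the `δ^j T_k`, with values in
`O' ⊗ B[δT, …, δ^r T]^`. -/
noncomputable def evalAtZero : MvPolynomial (ℕ × Fin g) O' →ₐ[O'] O' ⊗[O] JetRing p r g B :=
  aeval fun jk => 1 ⊗ₜ[O] toJetRing p r g B (atZero r g B jk)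

variable {g}

theorem evalAtZero_X_zero (k : Fin g) : evalAtZero p r g O O' B (X (0, k)) = 0 := by
  rw [evalAtZero, aeval_X, atZero, dif_neg (by simp), map_zero, TensorProduct.tmul_zero]

theorem evalAtZero_map (z : MvPolynomial (ℕ × Fin g) ℤ) :
    evalAtZero p r g O O' B (map (Int.castRingHom O') z) =
      1 ⊗ₜ[O] toJetRing p r g B (aeval (atZero r g B) z) := by
  let κ : JetRing p r g B →+* O' ⊗[O] JetRing p r g B :=
    (Algebra.TensorProduct.includeRight : _ →ₐ[O] O' ⊗[O] JetRing p r g B).toRingHom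
  have hcomp : (evalAtZero p r g O O' B).toRingHom.comp (map (Int.castRingHom O')) =
      (κ.comp (toJetRing p r g B)).comp (aeval (atZero r g B) : _ →ₐ[ℤ] _).toRingHom :=
    ringHom_ext (by simp) fun jk => by
      simp only [RingHom.comp_apply, map_X, AlgHom.toRingHom_eq_coe, RingHom.coe_coe, aeval_X]
      rw [evalAtZero, aeval_X]
      rfl
  exact congrArg (fun f => f z) hcomp

end EvalAtZero

section NaturalMap

open MvPolynomial

variable {p : ℕ} [Fact p.Prime] {O O' : Type} [CommRing O] [CommRing O'] [Algebra O O']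
  {F : FrobeniusBase p O} {F' : FrobeniusBase p O'}

theorem ProlSeq.Hom.map_phi {S S' : ProlSeq.{u} F} (v : S.Hom S') (r : ℕ) (x : S.obj r) :
    v.map (r + 1) (S.phi r x) = S'.phi r (v.map r x) := by
  change v.map (r + 1) (S.incl r x ^ p + algebraMap O _ F.ϖ * S.δ r x) =
    S'.incl r (v.map r x) ^ p + algebraMap O _ F.ϖ * S'.δ r (v.map r x)
  rw [map_add, map_pow, map_mul, AlgHom.commutes, v.map_incl, v.map_δ]

variable {S : ProlSeq.{u} F} {h : F.Extends F'} {hS : ∀ r, Module.Flat O (S.obj r)}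
  {Sπ : ProlSeq.{u} F'} {r g : ℕ}

variable (h hS) in
theorem ProlSeq.baseChange_phi (z : O' ⊗[O] S.obj r) :
    (S.baseChange h hS).phi r z = S.baseChangePhi h r z := by
  change S.baseChangeIncl O' r z ^ p + algebraMap O' (O' ⊗[O] S.obj (r + 1)) F'.ϖ *
    (S.baseChange_dvd h r z).choose = _
  rw [← (S.baseChange_dvd h r z).choose_spec, add_sub_cancel]

theorem ProlSeq.Hom.map_phiIter (v : Sπ.Hom (S.baseChange h hS)) {x : Sπ.obj 0} {b : S.obj 0}
    (hx : v.map 0 x = (1 : O') ⊗ₜ[O] b) (r : ℕ) :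
    v.map r (Sπ.phiIter r x) = (1 : O') ⊗ₜ[O] S.phiIter r b := by
  induction r with
  | zero => exact hx
  | succ r ih =>
    change v.map (r + 1) (Sπ.phi r (Sπ.phiIter r x)) = (1 : O') ⊗ₜ[O] S.phi r (S.phiIter r b)
    rw [v.map_phi, ih, S.baseChange_phi, S.baseChangePhi_tmul, map_one]

/-- `Ψ` is the homomorphism `S_π^r[δ_π T, …, δ_π^r T]^ → O' ⊗ S^r[δT, …, δ^r T]^` determined
by the morphism `v` of prolongation sequences; `IsNaturalMap` says this for the universal `v`. -/
structure IsInducedBy (v : Sπ.Hom (S.baseChange h hS))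
    (Ψ : JetRing p r g (Sπ.obj r) →+* O' ⊗[O] JetRing p r g (S.obj r)) : Prop where
  map_C (b : Sπ.obj r) : Ψ (toJetRing p r g _ (C b)) =
    Algebra.TensorProduct.map (AlgHom.id O' O')
      (IsScalarTower.toAlgHom O (S.obj r) (JetRing p r g (S.obj r))) (v.map r b)
  map_X (i : Fin r) (k : Fin g) : Ψ (toJetRing p r g _ (X (i, k))) =
    evalAtZero p r g O O' (S.obj r) (deltaPoly g F' (i + 1) k)

namespace IsInducedBy

variable {v : Sπ.Hom (S.baseChange h hS)}
  {Ψ : JetRing p r g (Sπ.obj r) →+* O' ⊗[O] JetRing p r g (S.obj r)}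

theorem map_C_algebraMap (hΨ : IsInducedBy v Ψ) (a : O') :
    Ψ (toJetRing p r g _ (C (algebraMap O' _ a))) = algebraMap O' _ a := by
  rw [hΨ.map_C, AlgHom.commutes]
  exact AlgHom.commutes _ a

theorem map_C_phiIter (hΨ : IsInducedBy v Ψ) {x : Sπ.obj 0} {b : S.obj 0}
    (hx : v.map 0 x = (1 : O') ⊗ₜ[O] b) :
    Ψ (toJetRing p r g _ (C (Sπ.phiIter r x))) =
      1 ⊗ₜ[O] toJetRing p r g _ (C (S.phiIter r b)) := by
  rw [hΨ.map_C, v.map_phiIter hx]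
  exact Algebra.TensorProduct.map_tmul _ _ _ _

theorem evalAtZero_mem_range (hΨ : IsInducedBy v Ψ) {z : MvPolynomial (ℕ × Fin g) O'}
    (hz : z ∈ deltaSubalgebra g F' r) :
    evalAtZero p r g O O' (S.obj r) z ∈ (Ψ.comp (toJetRing p r g _)).range := by
  induction hz using Algebra.adjoin_induction with
  | mem z hz =>
    obtain ⟨j, hj, k, rfl⟩ := hz
    rcases j with _ | j
    · rw [deltaPoly, evalAtZero_X_zero]
      exact zero_mem _
    · exact ⟨X (⟨j, hj⟩, k), hΨ.map_X _ _⟩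
  | algebraMap a => exact ⟨C (algebraMap O' _ a), by
      rw [AlgHom.commutes]; exact hΨ.map_C_algebraMap a⟩
  | add x y _ _ hx hy => rw [map_add]; exact add_mem hx hy
  | mul x y _ _ hx hy => rw [map_mul]; exact mul_mem hx hy

theorem exists_ϖ_mul_eq (hΨ : IsInducedBy v Ψ) (i : Fin g) :
    ∃ Q, algebraMap O' _ F'.ϖ * Ψ (toJetRing p r g _ Q) =
      1 ⊗ₜ[O] toJetRing p r g (S.obj r) (phiAtZero p r (S.obj r) i) := by
  obtain ⟨q, hq, hφ⟩ := exists_iterate_phiPoly_eq F' r i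
  obtain ⟨Q, hQ⟩ := hΨ.evalAtZero_mem_range hq
  refine ⟨Q, ?_⟩
  rw [phiAtZero, ← evalAtZero_map, map_iterate_phiPoly F'.φ, MvPolynomial.map_X, hφ, map_add,
    map_pow, evalAtZero_X_zero, zero_pow (pow_ne_zero _ (Fact.out : p.Prime).ne_zero), zero_add,
    map_mul, ← hQ, ← algebraMap_eq, AlgHom.commutes, RingHom.comp_apply]

end IsInducedBy

theorem existsUnique_isInducedBy [Module.Free O O'] [Module.Finite O O']
    (v : Sπ.Hom (S.baseChange h hS)) :
    ∃! Ψ : JetRing p r g (Sπ.obj r) →+* O' ⊗[O] JetRing p r g (S.obj r), IsInducedBy v Ψ := by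
  let τ : O' ⊗[O] S.obj r →+* O' ⊗[O] JetRing p r g (S.obj r) :=
    (Algebra.TensorProduct.map (AlgHom.id O' O')
      (IsScalarTower.toAlgHom O (S.obj r) (JetRing p r g (S.obj r)))).toRingHom
  let f : MvPolynomial (Fin r × Fin g) (Sπ.obj r) →+* O' ⊗[O] JetRing p r g (S.obj r) :=
    eval₂Hom (τ.comp (v.map r).toRingHom) fun ik =>
      evalAtZero p r g O O' (S.obj r) (deltaPoly g F' (ik.1 + 1) ik.2)
  have hfC (b : Sπ.obj r) : f (C b) = τ (v.map r b) := eval₂_C _ _ _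
  have hfX (i : Fin r) (k : Fin g) : f (X (i, k)) =
    evalAtZero p r g O O' (S.obj r) (deltaPoly g F' (i + 1) k) := eval₂_X _ _ _
  obtain ⟨Ψ, hΨ⟩ := exists_ringHom_adicCompletion (p := p) f
  refine ⟨Ψ, ⟨fun b => ?_, fun i k => ?_⟩, fun Ψ' hΨ' => ?_⟩
  · exact (congrArg (fun f => f (C b)) hΨ).trans (hfC b)
  · exact (congrArg (fun f => f (X (i, k))) hΨ).trans (hfX i k)
  · refine ringHom_adicCompletion_ext (p := p) (Eq.trans ?_ hΨ.symm)
    exact ringHom_ext (fun b => (hΨ'.map_C b).trans (hfC b).symm) fun ik =>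
      (hΨ'.map_X ik.1 ik.2).trans (hfX ik.1 ik.2).symm

theorem exists_dvd_sub_map_tensorProduct {A B : Type*} [CommRing A] [Algebra O A] [CommRing B]
    [Algebra O B] {ι : A →ₐ[O] B} {n : ℕ} (hι : ∀ s, ∃ a, (n : B) ∣ s - ι a)
    (c : O' ⊗[O] B) :
    ∃ x, (n : O' ⊗[O] B) ∣ c - Algebra.TensorProduct.map (AlgHom.id O' O') ι x := by
  induction c with
  | zero => exact ⟨0, by simp⟩
  | add c c' hc hc' =>
    obtain ⟨a, ha⟩ := hc
    obtain ⟨a', ha'⟩ := hc'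
    exact ⟨a + a', by rw [map_add, add_sub_add_comm]; exact dvd_add ha ha'⟩
  | tmul y s =>
    obtain ⟨a, d, hd⟩ := hι s
    refine ⟨y ⊗ₜ a, y ⊗ₜ d, ?_⟩
    rw [Algebra.TensorProduct.map_tmul, AlgHom.id_apply, ← TensorProduct.tmul_sub, hd,
      ← nsmul_eq_mul, ← nsmul_eq_mul, TensorProduct.tmul_smul]

variable [Module.Free O O'] [Module.Finite O O'] {A : Type u} [CommRing A] [Algebra O A]
  {ι : A →ₐ[O] S.obj 0} {ιπ : O' ⊗[O] A →ₐ[O'] Sπ.obj 0}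

theorem ProlSeq.Hom.map_zero_surjective (hS : S.IsJet ι) (hSπ : Sπ.InProl)
    (v : Sπ.Hom (S.baseChange h hS.inProl.flat))
    (hv : ∀ x, v.map 0 (ιπ x) = Algebra.TensorProduct.map (AlgHom.id O' O') ι x) :
    Function.Surjective (v.map 0) := by
  have := hSπ.complete 0
  have := hS.inProl.complete 0
  let f : Sπ.obj 0 →+* O' ⊗[O] S.obj 0 := (v.map 0).toRingHom
  refine surjective_of_forall_dvd_sub (p := p) (f := f) fun c => ?_
  obtain ⟨x, hx⟩ := exists_dvd_sub_map_tensorProduct (n := p)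
    (fun s => pow_one (p : S.obj 0) ▸ hS.completion_surjective 1 s) c
  exact ⟨ιπ x, (hv x).symm ▸ hx⟩

theorem existsUnique_isNaturalMap (hS : S.IsJet ι) (hSπ : Sπ.IsJet ιπ) :
    ∃! Ψ : JetRing p r g (Sπ.obj r) →+* O' ⊗[O] JetRing p r g (S.obj r),
      IsNaturalMap S ι h hS.inProl.flat Sπ ιπ r g Ψ := by
  obtain ⟨v, hv, hunique⟩ := hSπ.universal _ (hS.inProl.baseChange h)
    (Algebra.TensorProduct.map (AlgHom.id O' O') ι : O' ⊗[O] A →ₐ[O'] O' ⊗[O] S.obj 0)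
  obtain ⟨Ψ, hΨ, hΨ_unique⟩ := existsUnique_isInducedBy (r := r) (g := g) v
  refine ⟨Ψ, ⟨v, hv, hΨ.map_C, hΨ.map_X⟩, ?_⟩
  rintro Ψ' ⟨v', hv', hC, hX⟩
  obtain rfl := hunique v' hv'
  exact hΨ_unique Ψ' ⟨hC, hX⟩

end NaturalMap

section Membership

open Filter MvPolynomial

variable {p : ℕ} [Fact p.Prime] {O O' : Type} [CommRing O] [CommRing O'] [Algebra O O']
  {F : FrobeniusBase p O} {F' : FrobeniusBase p O'} {h : F.Extends F'} {S : ProlSeq.{u} F}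
  {hS : ∀ r, Module.Flat O (S.obj r)} {Sπ : ProlSeq.{u} F'} {r g e : ℕ}
  {v : Sπ.Hom (S.baseChange h hS)}
  {Ψ : JetRing p r g (Sπ.obj r) →+* O' ⊗[O] JetRing p r g (S.obj r)}

namespace IsInducedBy

theorem exists_ϖ_pow_degree_mul_eq (hΨ : IsInducedBy v Ψ) (α : Fin g →₀ ℕ) :
    ∃ Q, algebraMap O' _ F'.ϖ ^ α.degree * Ψ (toJetRing p r g _ Q) =
      1 ⊗ₜ[O] toJetRing p r g (S.obj r) (α.prod fun i n => phiAtZero p r (S.obj r) i ^ n) := by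
  choose Q hQ using hΨ.exists_ϖ_mul_eq
  let κ : JetRing p r g (S.obj r) →+* O' ⊗[O] JetRing p r g (S.obj r) :=
    (Algebra.TensorProduct.includeRight : _ →ₐ[O] O' ⊗[O] JetRing p r g (S.obj r)).toRingHom
  refine ⟨α.prod fun i n => Q i ^ n, ?_⟩
  change _ = κ _
  simp only [map_finsuppProd, map_pow]
  rw [← finsupp_prod_mul_pow]
  exact Finsupp.prod_congr fun i _ => congrArg (· ^ α i) (hQ i)

theorem exists_pow_dvd_and_map_eq [IsNoetherianRing (S.obj r)] (hΨ : IsInducedBy v Ψ)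
    (he : 0 < e) (hϖ : (p : O') ∣ F'.ϖ ^ e) {α : Fin g →₀ ℕ} {x : Sπ.obj 0} {b : S.obj 0}
    (hx : v.map 0 x = (1 : O') ⊗ₜ[O] b) (hb : α = 0 → b = 0) :
    ∃ y, (p : JetRing p r g (Sπ.obj r)) ^ (α.degree / e - Nat.log p α.degree) ∣ y ∧
      Ψ y = 1 ⊗ₜ[O] ((p : JetRing p r g (S.obj r)) ^ (Nat.log p e + 2) *
        toJetRing p r g _ (jetTerm p r (S.phiIter r b) α)) := by
  have := hS r
  obtain ⟨d, hpd, hd⟩ := exists_pow_log_mul_eq (Fact.out : p.Prime).one_lt he hϖ α.degree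
  obtain ⟨Q, hQ⟩ := hΨ.exists_ϖ_pow_degree_mul_eq α
  let θ : O' →+* JetRing p r g (Sπ.obj r) :=
    (toJetRing p r g _).comp (C.comp (algebraMap O' (Sπ.obj r)))
  let κ : JetRing p r g (S.obj r) →+* O' ⊗[O] JetRing p r g (S.obj r) :=
    (Algebra.TensorProduct.includeRight : _ →ₐ[O] O' ⊗[O] JetRing p r g (S.obj r)).toRingHom
  refine ⟨θ d * (toJetRing p r g _ (C (Sπ.phiIter r x)) * toJetRing p r g _ Q),
    Dvd.dvd.mul_right (by simpa only [map_pow, map_natCast] using map_dvd θ hpd) _, ?_⟩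
  have hp : (p : O') ∈ nonZeroDivisors O' := by
    obtain ⟨c, hc⟩ := hϖ
    exact (mul_mem_nonZeroDivisors.1 (hc ▸ pow_mem h.ϖ_mem e)).1
  refine ((isLeftRegular_natCast_of_flat hp).pow (Nat.log p α.degree)) ?_
  have hterm := congrArg (κ.comp (toJetRing p r g _)) <|
    pow_log_succ_mul_jetTerm (p := p) r (b := S.phiIter r b) (α := α) fun hα => by
      rw [hb hα, map_zero]
  have hd' := congrArg (algebraMap O' (O' ⊗[O] JetRing p r g (S.obj r))) hd
  have hθ : Ψ (θ d) = algebraMap O' _ d := hΨ.map_C_algebraMap d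
  have hC : Ψ (toJetRing p r g _ (C (Sπ.phiIter r x))) =
      κ (toJetRing p r g _ (C (S.phiIter r b))) := hΨ.map_C_phiIter hx
  change _ = κ (toJetRing p r g _ _) at hQ
  simp only [map_mul, map_pow, map_natCast, RingHom.comp_apply] at hd' hterm
  change _ * Ψ _ = _ * κ _
  simp only [map_mul, map_pow, map_natCast, hθ, hC]
  linear_combination κ (toJetRing p r g _ (C (S.phiIter r b))) *
    (Ψ (toJetRing p r g _ Q) * hd' + p ^ (Nat.log p e + 1) * hQ) - p ^ (Nat.log p e + 1) * hterm

theorem tmul_pow_mul_mem_range [Module.Free O O'] [Module.Finite O O'] [IsNoetherianRing (S.obj r)]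
    (hΨ : IsInducedBy v Ψ) (he : 0 < e) (hϖ : (p : O') ∣ F'.ϖ ^ e)
    (hv : Function.Surjective (v.map 0)) {b : (Fin g →₀ ℕ) → S.obj 0} (hb : b 0 = 0)
    {x : JetRing p r g (S.obj r)}
    (hx : HasPadicSum p (fun α => toJetRing p r g _ (jetTerm p r (S.phiIter r (b α)) α)) x) :
    (1 : O') ⊗ₜ[O] ((p : JetRing p r g (S.obj r)) ^ (Nat.log p e + 2) * x) ∈ Ψ.range := by
  choose b' hb' using fun α => hv ((1 : O') ⊗ₜ[O] b α)
  choose y hy hΨy using fun α =>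
    hΨ.exists_pow_dvd_and_map_eq he hϖ (hb' α) fun hα => (congrArg b hα).trans hb
  have hy0 (n : ℕ) : ∀ᶠ α in cofinite, (p : JetRing p r g (Sπ.obj r)) ^ n ∣ y α := by
    filter_upwards [tendsto_degree_cofinite.eventually (eventually_add_log_le_div
      (Fact.out : p.Prime).one_lt he n)] with α hα
    exact (pow_dvd_pow _ (Nat.le_sub_of_add_le hα)).trans (hy α)
  obtain ⟨Y, hY⟩ := exists_hasPadicSum hy0
  let κ : JetRing p r g (S.obj r) →+* O' ⊗[O] JetRing p r g (S.obj r) :=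
    (Algebra.TensorProduct.includeRight : _ →ₐ[O] O' ⊗[O] JetRing p r g (S.obj r)).toRingHom
  refine ⟨Y, (hY.map Ψ).unique ?_⟩
  simp only [hΨy]
  exact (hx.mul_left _).map κ

end IsInducedBy

theorem exists_hasExpansion_and_tmul_mem_range [Module.Free O O'] [Module.Finite O O']
    {A : Type u} [CommRing A] [Algebra O A] {ι : A →ₐ[O] S.obj 0}
    {ιπ : O' ⊗[O] A →ₐ[O'] Sπ.obj 0} (hS : S.IsJet ι) (hSπ : Sπ.InProl) (he : 0 < e)
    (hϖ : (p : O') ∣ F'.ϖ ^ e) {𝓕 : FormalGroupLaw g (S.obj 0)}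
    {l : Fin g → MvPowerSeries (Fin g) (ℚ ⊗[ℤ] S.obj 0)} (hl : 𝓕.IsLogarithm l) (k : Fin g) :
    ∃ x : JetRing p r g (S.obj r), HasExpansion x (jetLog S l r k) ∧
      ∀ Ψ : JetRing p r g (Sπ.obj r) →+* O' ⊗[O] JetRing p r g (S.obj r),
        IsNaturalMap S ι h hS.inProl.flat Sπ ιπ r g Ψ →
          (1 : O') ⊗ₜ[O] ((p : JetRing p r g (S.obj r)) ^ (Nat.log p e + 2) * x) ∈ Ψ.range := by
  have := hS.inProl.complete 0
  have := hS.inProl.noetherian r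
  obtain ⟨b, hb⟩ := hl.exists_isNumerator (p := p) Fact.out k
  have ht (n : ℕ) := eventually_pow_dvd_jetTerm (p := p) r (fun α => S.phiIter r (b α)) n
  obtain ⟨x, hx⟩ := exists_hasPadicSum (p := p)
    (t := fun α => toJetRing p r g _ (jetTerm p r (S.phiIter r (b α)) α)) fun n =>
    (ht n).mono fun α hα => by
      simpa only [map_pow, map_natCast] using map_dvd (toJetRing p r g (S.obj r)) hα
  refine ⟨x, hasExpansion_of_hasPadicSum r ht hx fun β =>
    coeff_inv_smul_subst r (hb.map (S.phiIter r)) β, ?_⟩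
  rintro Ψ ⟨v, hv, hC, hX⟩
  have hΨ : IsInducedBy v Ψ := ⟨hC, hX⟩
  exact hΨ.tmul_pow_mul_mem_range he hϖ (v.map_zero_surjective hS hSπ hv) hb.zero hx

end Membership

section Ramified

variable {p : ℕ} [Fact p.Prime] {π : Kalg p}

theorem finite_Rpi (hπ : IsPi π) : Module.Finite (R p) (Rpi π) :=
  (Algebra.adjoin.powerBasis' (isIntegral_pi hπ)).finite

theorem free_Rpi (hπ : IsPi π) : Module.Free (R p) (Rpi π) :=
  Module.Free.of_basis (Algebra.adjoin.powerBasis' (isIntegral_pi hπ)).basis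

theorem ramIndex_pos (hπ : IsPi π) : 0 < ramIndex π := by
  have := IntermediateField.adjoin.finiteDimensional
    ((isIntegral_pi hπ).tower_top : IsIntegral (K p) π)
  exact Module.finrank_pos

theorem natCast_dvd_piElt_pow_ramIndex (hπ : IsPi π) : (p : Rpi π) ∣ piElt π ^ ramIndex π := by
  have hint := isIntegral_pi hπ
  obtain ⟨⟨f, hmonic, heisenstein, -, hroot⟩, -⟩ := hπ
  have hdegree : ramIndex π = (f.map (algebraMap (R p) (Kalg p))).natDegree := by
    rw [ramIndex, IntermediateField.adjoin.finrank hint.tower_top,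
      minpoly.isIntegrallyClosed_eq_field_fractions' (K p) hint,
      minpoly_eq hmonic heisenstein hroot, hmonic.natDegree_map, hmonic.natDegree_map]
  obtain ⟨y, hy, hpy⟩ :=
    heisenstein.isWeaklyEisensteinAt.exists_mem_adjoin_mul_eq_pow_natDegree hroot hmonic
  refine ⟨⟨y, hy⟩, Subtype.ext ?_⟩
  change π ^ _ = ((p : Rpi π) : Kalg p) * y
  rw [hdegree, ← hpy, map_natCast]
  rfl

end Ramified

end PiJet

theorem proposition4p5_general {p : ℕ} [Fact p.Prime] {O O' : Type} [CommRing O] [CommRing O']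
    [Algebra O O'] [Module.Free O O'] [Module.Finite O O'] {F : FrobeniusBase p O}
    {F' : FrobeniusBase p O'} (h : F.Extends F') {e : ℕ} (he : 0 < e) (hϖ : (p : O') ∣ F'.ϖ ^ e)
    {A : Type u} [CommRing A] [Algebra O A] (S : ProlSeq.{u} F) (ι : A →ₐ[O] S.obj 0)
    (hS : S.IsJet ι) (Sπ : ProlSeq.{u} F') (ιπ : O' ⊗[O] A →ₐ[O'] Sπ.obj 0) (hSπ : Sπ.IsJet ιπ)
    {g : ℕ} (𝓕 : FormalGroupLaw g (S.obj 0))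
    (l : Fin g → MvPowerSeries (Fin g) (ℚ ⊗[ℤ] S.obj 0)) (hl : 𝓕.IsLogarithm l) (r : ℕ) :
    (∃! Ψ : JetRing p r g (Sπ.obj r) →+* O' ⊗[O] JetRing p r g (S.obj r),
      IsNaturalMap S ι h hS.inProl.flat Sπ ιπ r g Ψ) ∧
    ∃ L : Fin g → JetRing p r g (S.obj r),
      (∀ k, HasExpansion (L k) (jetLog S l r k)) ∧
      ∀ Ψ : JetRing p r g (Sπ.obj r) →+* O' ⊗[O] JetRing p r g (S.obj r),
        IsNaturalMap S ι h hS.inProl.flat Sπ ιπ r g Ψ →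
        ∀ k, (1 : O') ⊗ₜ[O] ((p : JetRing p r g (S.obj r)) ^ (Nat.log p e + 2) * L k) ∈
          Ψ.range := by
  choose L hexpansion hmem using
    exists_hasExpansion_and_tmul_mem_range (r := r) (h := h) (ιπ := ιπ) hS hSπ.inProl he hϖ hl
  exact ⟨existsUnique_isNaturalMap hS hSπ, L, hexpansion, fun Ψ hΨ k => hmem k Ψ hΨ⟩

theorem proposition4p5 {p : ℕ} [Fact p.Prime] (hp : 5 ≤ p)
    {φ : Kalg p ≃+* Kalg p} (hφ : ExtendsFrobenius φ) {π : Kalg p} (hπ : IsPi π)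
    {A : Type u} [CommRing A] [Algebra (R p) A] [Algebra.Smooth (R p) A]
    (S : ProlSeq.{u} (baseR p)) (ι : A →ₐ[R p] S.obj 0) (hS : S.IsJet ι)
    (Sπ : ProlSeq.{u} (baseRpi hφ hπ)) (ιπ : Rpi π ⊗[R p] A →ₐ[Rpi π] Sπ.obj 0)
    (hSπ : Sπ.IsJet ιπ)
    {g : ℕ} (𝓕 : FormalGroupLaw g (S.obj 0))
    (l : Fin g → MvPowerSeries (Fin g) (ℚ ⊗[ℤ] S.obj 0)) (hl : 𝓕.IsLogarithm l) (r : ℕ) :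
    (∃! Ψ : JetRing p r g (Sπ.obj r) →+* Rpi π ⊗[R p] JetRing p r g (S.obj r),
      IsNaturalMap S ι (baseR_extends hφ hπ) hS.inProl.flat Sπ ιπ r g Ψ) ∧
    ∃ L : Fin g → JetRing p r g (S.obj r),
      (∀ k, HasExpansion (L k) (jetLog S l r k)) ∧
      ∀ Ψ : JetRing p r g (Sπ.obj r) →+* Rpi π ⊗[R p] JetRing p r g (S.obj r),
        IsNaturalMap S ι (baseR_extends hφ hπ) hS.inProl.flat Sπ ιπ r g Ψ →
        ∀ k, (1 : Rpi π) ⊗ₜ[R p] ((p : JetRing p r g (S.obj r)) ^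
          (⌊Real.log (ramIndex π) / Real.log p⌋₊ + 2) * L k) ∈ Ψ.range := by
  have hfree := free_Rpi hπ
  have hfinite := finite_Rpi hπ
  rw [Real.log_div_log, Real.natFloor_logb_natCast]
  exact proposition4p5_general (baseR_extends hφ hπ) (ramIndex_pos hπ)
    (natCast_dvd_piElt_pow_ramIndex hπ) S ι hS Sπ ιπ hSπ 𝓕 l hl r
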